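/- Let $T\ge 1$, $r\ge 1$, and let $\mathbb M=\sum_{j=1}^r a^{(1)}_j\otimes\cdots\otimes a^{(T)}_j\in\mathbb R^{n_1\times\cdots\times n_T}$ be a tensor of (canonical) rank exactly $r$. Put $A^{(t)}=\operatorname{span}\{a^{(t)}_1,\dots,a^{(t)}_r\}\subset\mathbb R^{n_t}$, and suppose that $A^{(1)},\dots,A^{(T-1)}$ have coherence at most $\mu_0$, where the coherence of a subspace $U\subset\mathbb R^n$ is $\mu(U)=\frac{n}{\dim U}\max_j\|P_Ue_j\|^2$. Let $0<\delta<1$ and $m_t=36\,r^{t-1/2}\mu_0^{t-1}\log(2r/\delta)$. Sequential Tensor Completion recovers an order-$T$ tensor recursively. A tensor of order $1$ is observed entirely. For order $T\ge2$, start with an empty orthonormal list $\mathcal U$ of tensors in $\mathbb R^{n_1\times\cdots\times n_{T-1}}$ and draw a random sample $\Omega$ of positions in $[n_1]\times\cdots\times[n_{T-1}]$ with budget $m_T$. Then, for $i=1,\dots,n_T$, observe the subtensor $\mathbb M_i$ (last coordinate fixed to $i$) on $\Omega$. If $\|\mathbb M_{i\Omega}-P_{\mathcal U_\Omega}\mathbb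 M_{i\Omega}\|^2>0$, complete $\mathbb M_i$ by a recursive call (with fresh randomness and budgets $m_t$, $t<T$), let $\hat{\mathbb M}_i$ be the result, and append $P_{\mathcal U^\perp}\hat{\mathbb M}_i/\|P_{\mathcal U^\perp}\hat{\mathbb M}_i\|$ to $\mathcal U$. Otherwise set $\hat{\mathbb M}_i=\mathcal U(\mathcal U_\Omega^T\mathcal U_\Omega)^{-1}\mathcal U_\Omega^T\mathbb M_{i\Omega}$. The output $\hat{\mathbb M}$ has subtensors $\hat{\mathbb M}_i$. The sampling rule is either of the following, and the result holds for both: every position is included independently with probability $\min(1,m_T/\prod_{t<T}n_t)$; or $\lfloor m_T\rfloor$ independent uniform draws are made with replacement. Let $N$ be the number of observations made by the algorithm, repeated ones counted each time. Let $$B=36\Big(\sum_{t=1}^T n_t\Big)r^{T-1/2}\mu_0^{T-1}\log(2r/\delta).$$ Then: 1. $\Pr[\hat{\mathbb M}=\mathbb M]\ge 1-5\delta Tr^T$. 2. The expected number of observations on the event of exact recovery is at most $B$, that is, $\mathbb E\big[N\,\mathbf 1_{\{\hat{\mathbb M}=\mathbb M\}}\big]\le B$. 3. Moreover, if $5\delta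 Tr^T<1$, then over all runs $\mathbb E[N]\le B/(1-5\delta Tr^T)$. -/

import Mathlib

open scoped ENNReal

noncomputable section

/-- Multi-indices of an order-`T` array with side lengths `n 0, …, n (T-1)`. -/
abbrev TIdx {T : ℕ} (n : Fin T → ℕ) : Type := (t : Fin T) → Fin (n t)

/-- Real order-`T` tensors with side lengths `n`, with the Euclidean inner product of their
vectorizations. Mode `t` of the mathematical text (`1 ≤ t ≤ T`) is the index `t - 1 : Fin T`. -/
abbrev Tensor {T : ℕ} (n : Fin T → ℕ) : Type := EuclideanSpace ℝ (TIdx n)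

/-- The side lengths of all modes but the last one. -/
abbrev initDims {T : ℕ} (n : Fin (T + 1) → ℕ) : Fin T → ℕ := fun t => n t.castSucc

/-- The subtensor obtained by fixing the coordinate of the last mode to `i`. -/
def lastSlice {T : ℕ} {n : Fin (T + 1) → ℕ} (M : Tensor n) (i : Fin (n (Fin.last T))) :
    Tensor (initDims n) :=
  WithLp.toLp 2 fun x => M (Fin.snoc (α := fun t => Fin (n t)) x i)

/-- The tensor with prescribed last-mode subtensors. -/
def ofLastSlices {T : ℕ} {n : Fin (T + 1) → ℕ}
    (S : Fin (n (Fin.last T)) → Tensor (initDims n)) : Tensor n :=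
  WithLp.toLp 2 fun x => S (x (Fin.last T)) (fun t => x t.castSucc)

/-- `∑ k, a 0 k ⊗ a 1 k ⊗ ⋯ ⊗ a (T-1) k`, a sum of `r` outer products. -/
def cpTensor {T r : ℕ} {n : Fin T → ℕ} (a : (t : Fin T) → Fin r → EuclideanSpace ℝ (Fin (n t))) :
    Tensor n :=
  WithLp.toLp 2 fun x => ∑ k, ∏ t, a t k (x t)

/-- The rank of a tensor: the least number of outer products that sum to it. -/
def tensorRank {T : ℕ} {n : Fin T → ℕ} (M : Tensor n) : ℕ :=
  sInf {s | ∃ a : (t : Fin T) → Fin s → EuclideanSpace ℝ (Fin (n t)), M = cpTensor a}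

/-- The coherence `(n / dim U) * max_j ‖P_U e_j‖²` of a subspace `U` of `ℝⁿ`. -/
def coherence {N : ℕ} (U : Submodule ℝ (EuclideanSpace ℝ (Fin N))) : ℝ :=
  (N : ℝ) / (Module.finrank ℝ U : ℝ) *
    ⨆ j : Fin N, ‖U.starProjection (EuclideanSpace.single j (1 : ℝ))‖ ^ 2

/-! ### Sampling of entries -/

/-- A random subset of `ι` containing each element independently with probability `q`. -/
def randomSubset (ι : Type) [Fintype ι] (q : ℝ≥0∞) (hq : q ≤ 1) : PMF (Finset ι) :=
  PMF.ofFintype (fun S => q ^ S.card * (1 - q) ^ (Fintype.card ι - S.card)) (by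
    rw [Fintype.sum_pow_mul_eq_add_pow, add_tsub_cancel_of_le hq, one_pow])

/-- `k` independent uniform draws from `ι`, with replacement (no draw at all if `ι` is empty). -/
def uniformDraws (ι : Type) [Fintype ι] (k : ℕ) : PMF (List ι) := by
  classical
  exact if h : Nonempty ι then
    (PMF.uniformOfFintype (Fin k → ι)).map List.ofFn
  else PMF.pure []

/-- The two standard ways of sampling about `m` entries uniformly at random. -/
inductive SamplingScheme
  /-- every entry is included independently, with the same probability -/
  | bernoulli
  /-- a fixed number of independent uniform draws, with replacement -/
  | withReplacement

/-- The law of the list `Ω` of sampled positions, for the sampling budget `m`: each position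
independently with probability `m / |ι|` (capped at `1`), or `⌊m⌋` uniform draws with
replacement. -/
def SamplingScheme.draw (σ : SamplingScheme) (ι : Type) [Fintype ι] (m : ℝ) : PMF (List ι) :=
  match σ with
  | .bernoulli =>
      (randomSubset ι (min 1 (ENNReal.ofReal (m / Fintype.card ι))) (min_le_left _ _)).map
        Finset.toList
  | .withReplacement => uniformDraws ι ⌊m⌋₊

/-! ### Projection test and reconstruction from sampled entries -/

/-- The sampled vector `v_Ω`. -/
def subsample {ι : Type} [Fintype ι] (Ω : List ι) (v : EuclideanSpace ℝ ι) :
    EuclideanSpace ℝ (Fin Ω.length) :=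
  WithLp.toLp 2 fun p => v (Ω.get p)

/-- The span of the sampled basis vectors `u_Ω`, `u ∈ U`. -/
def sampledSpan {ι : Type} [Fintype ι] (Ω : List ι) (U : List (EuclideanSpace ℝ ι)) :
    Submodule ℝ (EuclideanSpace ℝ (Fin Ω.length)) :=
  Submodule.span ℝ {w | ∃ u ∈ U, w = subsample Ω u}

/-- The projection test `‖y - P_{U_Ω} y‖² > 0` on the observed values `y`. -/
def Informative {ι : Type} [Fintype ι] (Ω : List ι) (U : List (EuclideanSpace ℝ ι))
    (y : EuclideanSpace ℝ (Fin Ω.length)) : Prop :=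
  0 < ‖y - (sampledSpan Ω U).starProjection y‖ ^ 2

/-- The matrix with columns `U`. -/
def basisMatrix {ι : Type} (U : List (EuclideanSpace ℝ ι)) : Matrix ι (Fin U.length) ℝ :=
  Matrix.of fun x j => U.get j x

/-- The matrix `U_Ω`: the rows of `U` at the sampled positions. -/
def sampledMatrix {ι : Type} (Ω : List ι) (U : List (EuclideanSpace ℝ ι)) :
    Matrix (Fin Ω.length) (Fin U.length) ℝ :=
  Matrix.of fun p j => U.get j (Ω.get p)

/-- The reconstruction `U (U_Ωᵀ U_Ω)⁻¹ U_Ωᵀ y` from the observed values `y`. -/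
def reconstruct {ι : Type} [Fintype ι] (Ω : List ι) (U : List (EuclideanSpace ℝ ι))
    (y : EuclideanSpace ℝ (Fin Ω.length)) : EuclideanSpace ℝ ι :=
  WithLp.toLp 2 ((basisMatrix U * ((sampledMatrix Ω U).transpose * sampledMatrix Ω U)⁻¹ *
    (sampledMatrix Ω U).transpose).mulVec y.ofLp)

/-- `U ∪ {P_{U^⊥} v / ‖P_{U^⊥} v‖}`. -/
def extendBasis {ι : Type} [Fintype ι] (U : List (EuclideanSpace ℝ ι))
    (v : EuclideanSpace ℝ ι) : List (EuclideanSpace ℝ ι) :=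
  let w := (Submodule.span ℝ {u | u ∈ U})ᗮ.starProjection v
  U ++ [(‖w‖⁻¹ : ℝ) • w]

/-! ### The algorithm -/

/-- The state of the sweep over the `k` last-mode subtensors: the current basis, the estimates of
the subtensors treated so far, and the number of entries observed so far. -/
structure SweepState (ι : Type) [Fintype ι] (k : ℕ) where
  basis : List (EuclideanSpace ℝ ι)
  est : Fin k → EuclideanSpace ℝ ι
  cost : ℕ

open Classical in
/-- Treatment of the `i`-th subtensor `S i`: observe it on `Ω`; if the projection test is positive,
complete it with `complete` and extend the basis, otherwise reconstruct it from the observations.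
Repeated observations are counted each time they are made. -/
def sweepStep {ι : Type} [Fintype ι] {k : ℕ}
    (complete : EuclideanSpace ℝ ι → PMF (EuclideanSpace ℝ ι × ℕ))
    (Ω : List ι) (S : Fin k → EuclideanSpace ℝ ι) (i : Fin k) (s : SweepState ι k) :
    PMF (SweepState ι k) :=
  if Informative Ω s.basis (subsample Ω (S i)) then
    (complete (S i)).map fun out =>
      { basis := extendBasis s.basis out.1
        est := Function.update s.est i out.1
        cost := s.cost + Ω.length + out.2 }
  else
    PMF.pure
      { basis := s.basis
        est := Function.update s.est i (reconstruct Ω s.basis (subsample Ω (S i)))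
        cost := s.cost + Ω.length }

/-- The steps `sweepStep`, one after the other, along a list of positions. -/
def sweep {ι : Type} [Fintype ι] {k : ℕ}
    (complete : EuclideanSpace ℝ ι → PMF (EuclideanSpace ℝ ι × ℕ))
    (Ω : List ι) (S : Fin k → EuclideanSpace ℝ ι) :
    List (Fin k) → SweepState ι k → PMF (SweepState ι k)
  | [], s => PMF.pure s
  | i :: l, s => (sweepStep complete Ω S i s).bind (sweep complete Ω S l)

/-- Sequential Tensor Completion with budgets `m t`, where `m t` is used on tensors of order `t`.
The result is the joint law of the returned tensor and of the number of observed entries.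
Every call uses fresh randomness. A tensor of order one is observed in its entirety
(as is, for completeness, one of order zero). -/
def tensorCompletion (σ : SamplingScheme) (m : ℕ → ℝ) :
    (T : ℕ) → (n : Fin T → ℕ) → Tensor n → PMF (Tensor n × ℕ)
  | 0, _, M => PMF.pure (M, 1)
  | 1, n, M => PMF.pure (M, n 0)
  | T + 2, n, M =>
      (σ.draw (TIdx (initDims n)) (m (T + 2))).bind fun Ω =>
        (sweep (tensorCompletion σ m (T + 1) (initDims n)) Ω (lastSlice M)
          (List.finRange (n (Fin.last (T + 1)))) ⟨[], 0, 0⟩).map fun s =>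
            (ofLastSlices s.est, s.cost)

/-- The budgets `m_t = 36 r^{t-1/2} μ₀^{t-1} log(2r/δ)`, `t ≥ 1`. -/
def budget (r : ℕ) (μ₀ δ : ℝ) (t : ℕ) : ℝ :=
  36 * (r : ℝ) ^ ((t : ℝ) - 1 / 2) * μ₀ ^ (t - 1) * Real.log (2 * r / δ)

open Classical in
/-- The probability that a run with law `P` returns `M`. -/
def successProb {α : Type} (P : PMF (α × ℕ)) (M : α) : ℝ≥0∞ :=
  ∑' o : α × ℕ, if o.1 = M then P o else 0

/-- The expected number of observations `𝔼[N]` of a run with law `P`. -/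
def expectedCost {α : Type} (P : PMF (α × ℕ)) : ℝ≥0∞ :=
  ∑' o : α × ℕ, P o * (o.2 : ℝ≥0∞)

open Classical in
/-- The expected number of observations in runs that return `M`, that is, the expectation
`𝔼[N ; output = M]` over the event that the output is `M`. -/
def expectedCostOnSuccess {α : Type} (P : PMF (α × ℕ)) (M : α) : ℝ≥0∞ :=
  ∑' o : α × ℕ, if o.1 = M then P o * (o.2 : ℝ≥0∞) else 0

end

/-! All last-mode subtensors of `M` lie in one space `W`, the span of the `r` outer products of the
remaining factors, so `dim W ≤ r`. The sample Ω is good if no nonzero vector of `W` vanishes on it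
(`Determines`). For a good Ω and a basis inside `W`, the projection test is positive exactly when
the new subtensor leaves the current span, and reconstruction is exact otherwise. A correct
recursive call raises the dimension of the span inside `W`, so at most `r` calls are made before one
of them fails.

Ω is good with high probability by a dimension count. If unit vectors of `W` have squared entries at
most `s`, this also holds for the subspace `V` of vectors vanishing on the positions seen so far.
The trace of the projection onto `V` is `dim V`, and its diagonal entries are at most `s`, so at
least `dim V / s` positions carry a nonzero entry of some vector of `V`. Sampling such a position
lowers `dim V`, hence one uniform draw multiplies its expectation by at most `1 - 1/(s|ι|)`.
Coherence gives each factor space spread `r μ₀ / n t`, and spreads multiply over outer products, so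
`s|ι|` is a power of `r μ₀`, the one by which the budget exceeds the order-one budget. Markov's
inequality bounds the probability of a bad Ω by `δ²`.

The failure probability at one order is therefore at most `δ²` plus `r` times that of the order
below, giving `δ² T r^T`. On exact recovery, the cost is at most one sample per subtensor plus `r`
recursive costs. Over all runs, a failed call may gain no dimension; if calls fail with probability
at most `5δ`, the cost of gaining a dimension grows by a factor `1/(1 - 5δ)` at each order, and
Bernoulli's inequality absorbs the accumulated factor. -/

/-- A subspace is `s`-spread if its unit vectors have squared entries at most `s`. -/
def Spread {ι : Type} [Fintype ι] (W : Submodule ℝ (EuclideanSpace ℝ ι)) (s : ℝ) : Prop :=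
  ∀ w ∈ W, ∀ x, w x ^ 2 ≤ s * ‖w‖ ^ 2

/-- The vectors of `W` that vanish on `A`. -/
def vanishingOn {ι : Type} [Fintype ι] (W : Submodule ℝ (EuclideanSpace ℝ ι)) (A : Set ι) :
    Submodule ℝ (EuclideanSpace ℝ ι) where
  carrier := {w | w ∈ W ∧ ∀ x ∈ A, w x = 0}
  add_mem' := by
    rintro v w ⟨hv, hv'⟩ ⟨hw, hw'⟩
    exact ⟨W.add_mem hv hw, fun x hx => by simp [hv' x hx, hw' x hx]⟩
  zero_mem' := ⟨W.zero_mem, fun x _ => by simp⟩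
  smul_mem' := by
    rintro c w ⟨hw, hw'⟩
    exact ⟨W.smul_mem c hw, fun x hx => by simp [hw' x hx]⟩

/-! ### Spread subspaces and the expected dimension left undetermined by a sample -/

section Spread

variable {ι : Type} [Fintype ι] {W : Submodule ℝ (EuclideanSpace ℝ ι)} {s : ℝ}

open Classical in
-- The dimension is the trace of the orthogonal projection onto `W`. Its diagonal entries `d x` are
-- at most `s`, and they vanish where all of `W` vanishes.
theorem Spread.finrank_le (h : Spread W s) (hs : 0 ≤ s) :
    (Module.finrank ℝ W : ℝ) ≤
      s * (Finset.univ.filter fun x => ∃ w ∈ W, w x ≠ 0).card := by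
  let b := stdOrthonormalBasis ℝ W
  let d : ι → ℝ := fun x => ∑ i, ((b i : W) : EuclideanSpace ℝ ι) x ^ 2
  have hsum : (Module.finrank ℝ W : ℝ) = ∑ x, d x := by
    have h1 : ∀ i, ∑ x, ((b i : W) : EuclideanSpace ℝ ι) x ^ 2 = 1 := by
      intro i
      have := EuclideanSpace.real_norm_sq_eq ((b i : W) : EuclideanSpace ℝ ι)
      rw [← this, Submodule.norm_coe, b.orthonormal.1 i, one_pow]
    rw [Finset.sum_comm, Finset.sum_congr rfl fun i _ => h1 i]
    simp
  have hd0 : ∀ x, 0 ≤ d x := fun x => Finset.sum_nonneg fun i _ => sq_nonneg _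
  have hds : ∀ x, d x ≤ s := by
    intro x
    -- This is the projection of the basis vector at `x`; its entry at `x` equals its squared norm,
    -- so the spread bound reads `d x ^ 2 ≤ s * d x`.
    let w : W := ∑ i, ((b i : W) : EuclideanSpace ℝ ι) x • b i
    have hw : (w : EuclideanSpace ℝ ι) x = d x := by
      simp [w, d, pow_two]
    have hn : ‖(w : EuclideanSpace ℝ ι)‖ ^ 2 = d x := by
      rw [Submodule.norm_coe, ← b.sum_sq_norm_inner_right w]
      refine Finset.sum_congr rfl fun i _ => ?_
      rw [b.orthonormal.inner_right_fintype]
      simp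
    have := h w w.2 x
    rw [hw, hn, pow_two] at this
    rcases (hd0 x).eq_or_lt with h0 | h0
    · rw [← h0]; exact hs
    · exact le_of_mul_le_mul_right this h0
  have hdz : ∀ x, ¬ (∃ w ∈ W, w x ≠ 0) → d x = 0 := by
    intro x hx
    push Not at hx
    exact Finset.sum_eq_zero fun i _ => by rw [hx _ (b i).2]; simp
  rw [hsum, ← Finset.sum_filter_add_sum_filter_not _ (fun x => ∃ w ∈ W, w x ≠ 0),
    Finset.sum_eq_zero (s := Finset.univ.filter fun x => ¬ (∃ w ∈ W, w x ≠ 0))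
      fun x hx => hdz x (Finset.mem_filter.1 hx).2, add_zero]
  calc _ ≤ ∑ x ∈ Finset.univ.filter fun x => ∃ w ∈ W, w x ≠ 0, s :=
        Finset.sum_le_sum fun x _ => hds x
    _ = _ := by simp [mul_comm]

theorem vanishingOn_le (W : Submodule ℝ (EuclideanSpace ℝ ι)) (A : Set ι) :
    vanishingOn W A ≤ W := fun _ h => h.1

theorem vanishingOn_anti (W : Submodule ℝ (EuclideanSpace ℝ ι)) {A B : Set ι} (h : A ⊆ B) :
    vanishingOn W B ≤ vanishingOn W A := fun _ hw => ⟨hw.1, fun x hx => hw.2 x (h hx)⟩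

theorem vanishingOn_univ (W : Submodule ℝ (EuclideanSpace ℝ ι)) :
    vanishingOn W Set.univ = ⊥ := by
  rw [eq_bot_iff]
  intro w hw
  rw [Submodule.mem_bot]
  ext x
  exact hw.2 x trivial

theorem Spread.mono {V : Submodule ℝ (EuclideanSpace ℝ ι)} (h : Spread W s) (hV : V ≤ W) :
    Spread V s := fun w hw => h w (hV hw)

theorem finrank_vanishingOn_insert_add_one_le {A : Set ι} {x : ι}
    (hx : ∃ w ∈ vanishingOn W A, w x ≠ 0) :
    Module.finrank ℝ (vanishingOn W (insert x A)) + 1 ≤ Module.finrank ℝ (vanishingOn W A) := by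
  refine Submodule.finrank_lt_finrank_of_lt (lt_of_le_of_ne
    (vanishingOn_anti W (Set.subset_insert x A)) fun h => ?_)
  obtain ⟨w, hw, hwx⟩ := hx
  rw [← h] at hw
  exact hwx (hw.2 x (Set.mem_insert x A))

/-- Adding a uniformly random position to `A` multiplies the expected dimension of the space of
vectors that are not determined yet by at most `1 - 1 / (s |ι|)`. -/
theorem Spread.sum_finrank_vanishingOn_insert_le (h : Spread W s) (hs : 0 < s) (A : Set ι) :
    ∑ x, (Module.finrank ℝ (vanishingOn W (insert x A)) : ℝ) ≤
      (Fintype.card ι - s⁻¹) * Module.finrank ℝ (vanishingOn W A) := by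
  classical
  have h1 := (h.mono (vanishingOn_le W A)).finrank_le hs.le
  have h2 : ∀ x, (Module.finrank ℝ (vanishingOn W (insert x A)) : ℝ) ≤
      Module.finrank ℝ (vanishingOn W A) - if ∃ w ∈ vanishingOn W A, w x ≠ 0 then 1 else 0 := by
    intro x
    split_ifs with hx
    · have := finrank_vanishingOn_insert_add_one_le hx
      rw [le_sub_iff_add_le]
      exact_mod_cast this
    · rw [sub_zero]
      exact_mod_cast Submodule.finrank_mono (vanishingOn_anti W (Set.subset_insert x A))
  have h3 : s⁻¹ * (Module.finrank ℝ (vanishingOn W A) : ℝ) ≤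
      (Finset.univ.filter fun x => ∃ w ∈ vanishingOn W A, w x ≠ 0).card := by
    rw [inv_mul_le_iff₀ hs]
    exact h1
  calc _ ≤ _ := Finset.sum_le_sum fun x _ => h2 x
    _ = Fintype.card ι * (Module.finrank ℝ (vanishingOn W A) : ℝ) -
        (Finset.univ.filter fun x => ∃ w ∈ vanishingOn W A, w x ≠ 0).card := by
      rw [Finset.sum_sub_distrib, Finset.sum_boole]
      simp
    _ ≤ _ := by linarith

theorem Spread.sum_draws_finrank_le (h : Spread W s) (hs : 0 < s)
    (hcard : 1 ≤ s * Fintype.card ι) (k : ℕ) :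
    ∑ f : Fin k → ι, (Module.finrank ℝ (vanishingOn W {x | x ∈ List.ofFn f}) : ℝ) ≤
      (Fintype.card ι - s⁻¹) ^ k * Module.finrank ℝ W := by
  induction k with
  | zero =>
    have := Submodule.finrank_mono (vanishingOn_le W {x | x ∈ List.ofFn (default : Fin 0 → ι)})
    simpa using this
  | succ k ih =>
    have h0 : 0 ≤ (Fintype.card ι : ℝ) - s⁻¹ := by
      rw [sub_nonneg, inv_le_iff_one_le_mul₀ hs, mul_comm]; exact hcard
    -- One draw is split off; the other `k` draws are the fixed set `A` of the one-step estimate.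
    rw [← (Fin.consEquiv fun _ : Fin (k + 1) => ι).sum_comp, Fintype.sum_prod_type_right]
    calc _ ≤ ∑ f : Fin k → ι, ((Fintype.card ι : ℝ) - s⁻¹) *
          (Module.finrank ℝ (vanishingOn W {x | x ∈ List.ofFn f}) : ℝ) := by
          refine Finset.sum_le_sum fun f _ => ?_
          refine le_of_eq_of_le (Finset.sum_congr rfl fun x _ => ?_)
            (h.sum_finrank_vanishingOn_insert_le hs {x | x ∈ List.ofFn f})
          have hset : {y | y ∈ List.ofFn ((Fin.consEquiv fun _ : Fin (k + 1) => ι) (x, f))} =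
              insert x {x | x ∈ List.ofFn f} := by
            ext y
            simp [Fin.consEquiv]
          rw [hset]
      _ ≤ _ := by
          rw [← Finset.mul_sum, pow_succ', mul_assoc]
          exact mul_le_mul_of_nonneg_left ih h0

/-- Double counting of the pairs of an `(N + 1)`-set and one of its elements, seen also as an
`N`-set and a new element. -/
theorem sum_powersetCard_succ [DecidableEq ι] (g : Finset ι → ℝ) (N : ℕ) :
    ((N : ℝ) + 1) * ∑ S ∈ Finset.univ.powersetCard (N + 1), g S =
      ∑ S ∈ (Finset.univ : Finset ι).powersetCard N, ∑ x ∈ Sᶜ, g (insert x S) := by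
  have h1 : ((N : ℝ) + 1) * ∑ S ∈ (Finset.univ : Finset ι).powersetCard (N + 1), g S =
      ∑ S ∈ (Finset.univ : Finset ι).powersetCard (N + 1), ∑ x ∈ S, g S := by
    rw [Finset.mul_sum]
    refine Finset.sum_congr rfl fun S hS => ?_
    rw [Finset.sum_const, (Finset.mem_powersetCard.1 hS).2]
    simp
  rw [h1, Finset.sum_sigma', Finset.sum_sigma']
  refine Finset.sum_bij' (fun p _ => ⟨p.1.erase p.2, p.2⟩) (fun p _ => ⟨insert p.2 p.1, p.2⟩)
    ?_ ?_ ?_ ?_ ?_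
  · rintro ⟨S, x⟩ h
    simp only [Finset.mem_sigma, Finset.mem_powersetCard_univ, Finset.mem_compl] at h ⊢
    exact ⟨by rw [Finset.card_erase_of_mem h.2, h.1]; rfl, Finset.notMem_erase _ _⟩
  · rintro ⟨S, x⟩ h
    simp only [Finset.mem_sigma, Finset.mem_powersetCard_univ, Finset.mem_compl] at h ⊢
    exact ⟨by rw [Finset.card_insert_of_notMem h.2, h.1], Finset.mem_insert_self _ _⟩
  · rintro ⟨S, x⟩ h
    simp only [Finset.mem_sigma] at h
    simp [Finset.insert_erase h.2]
  · rintro ⟨S, x⟩ h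
    simp only [Finset.mem_sigma, Finset.mem_compl] at h
    simp [Finset.erase_insert h.2]
  · rintro ⟨S, x⟩ h
    simp only [Finset.mem_sigma] at h
    simp [Finset.insert_erase h.2]

/-- Draws without replacement do no worse than draws with replacement: a position already in `S`
lowers no dimension, so the whole expected decrease comes from the complement of `S`. -/
theorem Spread.sum_powersetCard_finrank_le (h : Spread W s) (hs : 0 < s)
    (hcard : 1 ≤ s * Fintype.card ι) (N : ℕ) :
    ∑ S ∈ (Finset.univ : Finset ι).powersetCard N,
        (Module.finrank ℝ (vanishingOn W (S : Set ι)) : ℝ) ≤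
      (Fintype.card ι).choose N * (1 - (s * Fintype.card ι)⁻¹) ^ N * Module.finrank ℝ W := by
  classical
  set D := Fintype.card ι with hD
  set c : Finset ι → ℝ := fun S => (Module.finrank ℝ (vanishingOn W (S : Set ι)) : ℝ) with hc
  have hc0 : ∀ S, 0 ≤ c S := fun S => Nat.cast_nonneg _
  induction N with
  | zero =>
    simp only [Finset.powersetCard_zero, Finset.sum_singleton, Nat.choose_zero_right, pow_zero,
      Nat.cast_one, one_mul, hc]
    exact_mod_cast Submodule.finrank_mono (vanishingOn_le W _)
  | succ N ih =>
    rcases lt_or_ge D (N + 1) with hlt | hle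
    · rw [Finset.powersetCard_eq_empty.2 (by simpa using hlt), Nat.choose_eq_zero_of_lt hlt]
      simp
    have hD0 : (0 : ℝ) < D := by exact_mod_cast (by omega : 0 < D)
    have hK : (s * D)⁻¹ ≤ 1 := inv_le_one_of_one_le₀ hcard
    have hK0 : 0 < (s * D)⁻¹ := by positivity
    have hsK : s⁻¹ = D * (s * D)⁻¹ := by field_simp
    have hND : ((N : ℝ) + 1) ≤ D := by exact_mod_cast hle
    have hstep : ((N : ℝ) + 1) * ∑ S ∈ (Finset.univ : Finset ι).powersetCard (N + 1), c S ≤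
        ((D : ℝ) - N) * (1 - (s * D)⁻¹) * ∑ S ∈ (Finset.univ : Finset ι).powersetCard N, c S := by
      rw [sum_powersetCard_succ, Finset.mul_sum]
      refine Finset.sum_le_sum fun S hS => ?_
      have h1 := h.sum_finrank_vanishingOn_insert_le hs (S : Set ι)
      have h2 : ∑ x ∈ S, (Module.finrank ℝ (vanishingOn W (insert x (S : Set ι))) : ℝ) =
          N * c S := by
        rw [Finset.sum_congr rfl (g := fun _ => c S)
          fun x hx => by rw [Set.insert_eq_of_mem (Finset.mem_coe.2 hx)]]
        simp [(Finset.mem_powersetCard.1 hS).2]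
      rw [← Finset.sum_add_sum_compl S, h2] at h1
      have h3 : ∑ x ∈ Sᶜ, c (insert x S) =
          ∑ x ∈ Sᶜ, (Module.finrank ℝ (vanishingOn W (insert x (S : Set ι))) : ℝ) := by
        exact Finset.sum_congr rfl fun x _ => by simp only [hc]; rw [Finset.coe_insert]
      rw [h3]
      have h4 : (D - N : ℝ) * (s * D)⁻¹ ≤ s⁻¹ := by
        rw [hsK]
        have : (0 : ℝ) ≤ N := Nat.cast_nonneg _
        gcongr
        linarith
      have := mul_le_mul_of_nonneg_right h4 (hc0 S)
      simp only [hc, ← hD] at h1 this ⊢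
      nlinarith
    have hchoose : ((N : ℝ) + 1) * D.choose (N + 1) = (D - N) * D.choose N := by
      have := Nat.choose_succ_right_eq D N
      rw [← Nat.cast_sub (by omega : N ≤ D)]
      rw [mul_comm, mul_comm ((D - N : ℕ) : ℝ)]
      exact_mod_cast this
    have hN : (0 : ℝ) < (N : ℝ) + 1 := by positivity
    refine le_of_mul_le_mul_left (hstep.trans ?_) hN
    calc _ ≤ ((D : ℝ) - N) * (1 - (s * D)⁻¹) *
          (D.choose N * (1 - (s * D)⁻¹) ^ N * Module.finrank ℝ W) :=
          mul_le_mul_of_nonneg_left ih (mul_nonneg (by linarith) (by linarith))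
      _ = (((D : ℝ) - N) * D.choose N) * (1 - (s * D)⁻¹) ^ (N + 1) * Module.finrank ℝ W := by ring
      _ = _ := by rw [← hchoose]; ring

/-- Conditioned on its size, a Bernoulli subset is uniform. The bounds for fixed size add up by the
binomial theorem. -/
theorem Spread.sum_bernoulli_finrank_le (h : Spread W s) (hs : 0 < s)
    (hcard : 1 ≤ s * Fintype.card ι) {p : ℝ} (hp₀ : 0 ≤ p) (hp₁ : p ≤ 1) :
    ∑ S : Finset ι, p ^ S.card * (1 - p) ^ (Fintype.card ι - S.card) *
        (Module.finrank ℝ (vanishingOn W (S : Set ι)) : ℝ) ≤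
      (1 - p * (s * Fintype.card ι)⁻¹) ^ Fintype.card ι * Module.finrank ℝ W := by
  set D := Fintype.card ι with hD
  have h1 : ∑ S : Finset ι, p ^ S.card * (1 - p) ^ (D - S.card) *
        (Module.finrank ℝ (vanishingOn W (S : Set ι)) : ℝ) =
      ∑ N ∈ Finset.range (D + 1), p ^ N * (1 - p) ^ (D - N) *
        ∑ S ∈ (Finset.univ : Finset ι).powersetCard N,
          (Module.finrank ℝ (vanishingOn W (S : Set ι)) : ℝ) := by
    rw [← Finset.powerset_univ, Finset.sum_powerset, Finset.card_univ]
    refine Finset.sum_congr rfl fun N _ => ?_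
    rw [Finset.mul_sum]
    refine Finset.sum_congr rfl fun S hS => ?_
    rw [(Finset.mem_powersetCard.1 hS).2]
  rw [h1]
  calc _ ≤ ∑ N ∈ Finset.range (D + 1), p ^ N * (1 - p) ^ (D - N) *
        (D.choose N * (1 - (s * D)⁻¹) ^ N * Module.finrank ℝ W) := by
        refine Finset.sum_le_sum fun N _ => mul_le_mul_of_nonneg_left
          (h.sum_powersetCard_finrank_le hs hcard N) ?_
        have : 0 ≤ 1 - p := by linarith
        positivity
    _ = (p * (1 - (s * D)⁻¹) + (1 - p)) ^ D * Module.finrank ℝ W := by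
        rw [add_pow, Finset.sum_mul]
        refine Finset.sum_congr rfl fun N _ => ?_
        rw [mul_pow]
        ring
    _ = _ := by congr 2; ring

end Spread

/-! ### Expectations with values in `ℝ≥0∞`, free of summability conditions -/

/-- The expectation of `f` under `P`. -/
noncomputable def PMF.expect {α : Type*} (P : PMF α) (f : α → ℝ≥0∞) : ℝ≥0∞ := ∑' a, P a * f a

namespace PMF

variable {α β : Type*}

theorem expect_pure (a : α) (f : α → ℝ≥0∞) : (PMF.pure a).expect f = f a := by
  classical
  unfold expect
  rw [tsum_eq_single a]
  · simp
  · intro b hb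
    simp [hb]

theorem expect_bind (P : PMF α) (Q : α → PMF β) (f : β → ℝ≥0∞) :
    (P.bind Q).expect f = P.expect fun a => (Q a).expect f := by
  simp only [expect, PMF.bind_apply, ← ENNReal.tsum_mul_right, ← ENNReal.tsum_mul_left]
  rw [ENNReal.tsum_comm]
  simp only [mul_assoc]

theorem expect_map (P : PMF α) (g : α → β) (f : β → ℝ≥0∞) :
    (P.map g).expect f = P.expect fun a => f (g a) := by
  rw [PMF.map, expect_bind]
  simp [expect_pure]

theorem expect_mono (P : PMF α) {f g : α → ℝ≥0∞} (h : ∀ a, f a ≤ g a) :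
    P.expect f ≤ P.expect g :=
  ENNReal.tsum_le_tsum fun a => mul_le_mul_right (h a) _

theorem expect_const (P : PMF α) (c : ℝ≥0∞) : (P.expect fun _ => c) = c := by
  rw [expect, ENNReal.tsum_mul_right, P.tsum_coe, one_mul]

theorem expect_add (P : PMF α) (f g : α → ℝ≥0∞) :
    (P.expect fun a => f a + g a) = P.expect f + P.expect g := by
  simp only [expect, mul_add]
  exact ENNReal.tsum_add

theorem expect_mul_const (P : PMF α) (f : α → ℝ≥0∞) (c : ℝ≥0∞) :
    (P.expect fun a => f a * c) = P.expect f * c := by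
  simp only [expect, ← mul_assoc]
  exact ENNReal.tsum_mul_right

theorem expect_const_mul (P : PMF α) (f : α → ℝ≥0∞) (c : ℝ≥0∞) :
    (P.expect fun a => c * f a) = c * P.expect f := by
  simp only [mul_comm c, expect_mul_const]

theorem expect_fintype [Fintype α] (P : PMF α) (f : α → ℝ≥0∞) :
    P.expect f = ∑ a, P a * f a := tsum_fintype _

end PMF

/-! ### Probability that a random sample determines a subspace, and its expected size -/

/-- No nonzero vector of `W` vanishes at all the sampled positions. -/
def Determines {ι : Type} [Fintype ι] (Ω : List ι) (W : Submodule ℝ (EuclideanSpace ℝ ι)) : Prop :=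
  ∀ w ∈ W, (∀ x ∈ Ω, w x = 0) → w = 0

section Draw

variable {ι : Type} [Fintype ι]

open Classical in
-- The pointwise form of Markov's inequality: an undetermined space has dimension at least one.
theorem indicator_not_determines_le (Ω : List ι) (W : Submodule ℝ (EuclideanSpace ℝ ι)) :
    (if Determines Ω W then 0 else 1 : ℝ≥0∞) ≤
      ENNReal.ofReal (Module.finrank ℝ (vanishingOn W {x | x ∈ Ω})) := by
  split_ifs with h
  · exact zero_le
  · have : Module.finrank ℝ (vanishingOn W {x | x ∈ Ω}) ≠ 0 := by
      intro h0
      refine h fun w hw hx => ?_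
      have hmem : w ∈ vanishingOn W {x | x ∈ Ω} := ⟨hw, hx⟩
      rw [Submodule.finrank_eq_zero.1 h0] at hmem
      exact hmem
    rw [ENNReal.ofReal_natCast]
    exact_mod_cast Nat.one_le_iff_ne_zero.2 this

theorem Spread.expect_bernoulli_le {W : Submodule ℝ (EuclideanSpace ℝ ι)} {s : ℝ}
    (h : Spread W s) (hs : 0 < s) (hcard : 1 ≤ s * Fintype.card ι) {m : ℝ} (hm : 0 ≤ m) :
    ((SamplingScheme.bernoulli.draw ι m).expect fun Ω =>
        ENNReal.ofReal (Module.finrank ℝ (vanishingOn W {x | x ∈ Ω}))) ≤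
      ENNReal.ofReal (Module.finrank ℝ W * Real.exp (-m / (s * Fintype.card ι))) := by
  have hD : (0 : ℝ) < Fintype.card ι := by
    rcases (Nat.cast_nonneg (α := ℝ) (Fintype.card ι)).eq_or_lt with h0 | h0
    · rw [← h0] at hcard; norm_num at hcard
    · exact h0
  set p : ℝ := min 1 (m / Fintype.card ι) with hp
  have hp₀ : 0 ≤ p := le_min zero_le_one (by positivity)
  have hp₁ : p ≤ 1 := min_le_left _ _
  have hq : min 1 (ENNReal.ofReal (m / Fintype.card ι)) = ENNReal.ofReal p := by
    rw [hp, ENNReal.ofReal_mono.map_min, ENNReal.ofReal_one]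
  have hset : ∀ S : Finset ι, {x | x ∈ S.toList} = (S : Set ι) := by
    intro S; ext x; simp
  have hE : ((SamplingScheme.bernoulli.draw ι m).expect fun Ω =>
      ENNReal.ofReal (Module.finrank ℝ (vanishingOn W {x | x ∈ Ω}))) =
      ENNReal.ofReal (∑ S : Finset ι, p ^ S.card * (1 - p) ^ (Fintype.card ι - S.card) *
        (Module.finrank ℝ (vanishingOn W (S : Set ι)) : ℝ)) := by
    have hp₂ : 0 ≤ 1 - p := by linarith
    rw [SamplingScheme.draw, PMF.expect_map, PMF.expect_fintype,
      ENNReal.ofReal_sum_of_nonneg fun S _ => by positivity]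
    refine Finset.sum_congr rfl fun S _ => ?_
    rw [hset, ENNReal.ofReal_mul (by positivity), ENNReal.ofReal_mul (by positivity),
      ENNReal.ofReal_pow hp₀, ENNReal.ofReal_pow hp₂, ENNReal.ofReal_sub _ hp₀,
      ENNReal.ofReal_one]
    simp only [randomSubset, PMF.ofFintype_apply, hq]
  rw [hE]
  refine ENNReal.ofReal_le_ofReal ?_
  -- When the inclusion probability is capped at `1`, the bound in terms of `p` can be weaker than
  -- the one in `m`. But then every position is sampled and nothing is left undetermined.
  rcases le_or_gt 1 (m / Fintype.card ι) with h1 | h1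
  · have hp1 : p = 1 := min_eq_left h1
    refine le_of_eq_of_le (Finset.sum_eq_zero fun S _ => ?_) (by positivity)
    rcases (Finset.card_le_univ S).eq_or_lt with hS | hS
    · rw [(Finset.card_eq_iff_eq_univ S).1 hS, Finset.coe_univ, vanishingOn_univ]
      simp
    · rw [hp1, sub_self, zero_pow (by omega)]
      simp
  · refine (h.sum_bernoulli_finrank_le hs hcard hp₀ hp₁).trans ?_
    rw [mul_comm]
    refine mul_le_mul_of_nonneg_left ?_ (Nat.cast_nonneg _)
    have hpm : p = m / Fintype.card ι := min_eq_right h1.le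
    have hle : p * (s * Fintype.card ι)⁻¹ ≤ 1 :=
      mul_le_one₀ hp₁ (by positivity) (inv_le_one_of_one_le₀ hcard)
    calc _ ≤ Real.exp (-(p * (s * Fintype.card ι)⁻¹)) ^ Fintype.card ι :=
          pow_le_pow_left₀ (by linarith) (Real.one_sub_le_exp_neg _) _
      _ = _ := by
          rw [← Real.exp_nat_mul, hpm]
          congr 1
          field_simp

theorem expect_uniformDraws [Nonempty ι] (k : ℕ) (f : List ι → ℝ) (hf : ∀ Ω, 0 ≤ f Ω) :
    ((uniformDraws ι k).expect fun Ω => ENNReal.ofReal (f Ω)) =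
      ENNReal.ofReal (((Fintype.card ι : ℝ) ^ k)⁻¹ * ∑ g : Fin k → ι, f (List.ofFn g)) := by
  classical
  have hD : (0 : ℝ) < Fintype.card ι := by exact_mod_cast Fintype.card_pos
  rw [uniformDraws, dif_pos ‹Nonempty ι›, PMF.expect_map, PMF.expect_fintype, Finset.mul_sum,
    ENNReal.ofReal_sum_of_nonneg fun g _ => mul_nonneg (by positivity) (hf _)]
  refine Finset.sum_congr rfl fun g _ => ?_
  rw [ENNReal.ofReal_mul (by positivity), PMF.uniformOfFintype_apply,
    ENNReal.ofReal_inv_of_pos (by positivity), ENNReal.ofReal_pow hD.le, ENNReal.ofReal_natCast]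
  simp

theorem Spread.expect_withReplacement_le {W : Submodule ℝ (EuclideanSpace ℝ ι)} {s : ℝ}
    (h : Spread W s) (hs : 0 < s) (hcard : 1 ≤ s * Fintype.card ι) (m : ℝ) :
    ((SamplingScheme.withReplacement.draw ι m).expect fun Ω =>
        ENNReal.ofReal (Module.finrank ℝ (vanishingOn W {x | x ∈ Ω}))) ≤
      ENNReal.ofReal (Module.finrank ℝ W * Real.exp (-(m - 1) / (s * Fintype.card ι))) := by
  have hD : (0 : ℝ) < Fintype.card ι := by
    rcases (Nat.cast_nonneg (α := ℝ) (Fintype.card ι)).eq_or_lt with h0 | h0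
    · rw [← h0] at hcard; norm_num at hcard
    · exact h0
  have : Nonempty ι := Fintype.card_pos_iff.1 (by exact_mod_cast hD)
  rw [SamplingScheme.draw, expect_uniformDraws ⌊m⌋₊
    (fun Ω => (Module.finrank ℝ (vanishingOn W {x | x ∈ Ω}) : ℝ)) fun _ => Nat.cast_nonneg _]
  refine ENNReal.ofReal_le_ofReal ?_
  have hK : (s * Fintype.card ι)⁻¹ ≤ 1 := inv_le_one_of_one_le₀ hcard
  set k := ⌊m⌋₊
  -- Rounding the budget down is what puts `m - 1` in the exponent.
  have hk : m - 1 ≤ k := (Nat.sub_one_lt_floor m).le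
  calc _ ≤ ((Fintype.card ι : ℝ) ^ k)⁻¹ *
        ((Fintype.card ι - s⁻¹) ^ k * Module.finrank ℝ W) :=
        mul_le_mul_of_nonneg_left (h.sum_draws_finrank_le hs hcard k) (by positivity)
    _ = Module.finrank ℝ W * (1 - (s * Fintype.card ι)⁻¹) ^ k := by
        have : (1 - (s * Fintype.card ι)⁻¹) = (Fintype.card ι - s⁻¹) / Fintype.card ι := by
          field_simp
        rw [this, div_pow]
        field_simp
    _ ≤ Module.finrank ℝ W * Real.exp (-(s * Fintype.card ι)⁻¹) ^ k :=
        mul_le_mul_of_nonneg_left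
          (pow_le_pow_left₀ (by linarith) (Real.one_sub_le_exp_neg _) _) (Nat.cast_nonneg _)
    _ ≤ _ := by
        rw [← Real.exp_nat_mul]
        refine mul_le_mul_of_nonneg_left (Real.exp_le_exp.2 ?_) (Nat.cast_nonneg _)
        rw [neg_div, mul_neg, neg_le_neg_iff, div_eq_mul_inv]
        exact mul_le_mul_of_nonneg_right hk (by positivity)

open Classical in
/-- The sampled positions determine a spread subspace with high probability. -/
theorem Spread.expect_not_determines_le (σ : SamplingScheme)
    {W : Submodule ℝ (EuclideanSpace ℝ ι)} {s : ℝ}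
    (h : Spread W s) (hs : 0 < s) (hcard : 1 ≤ s * Fintype.card ι) {m : ℝ} (hm : 0 ≤ m) :
    ((σ.draw ι m).expect fun Ω => if Determines Ω W then 0 else 1) ≤
      ENNReal.ofReal (Module.finrank ℝ W * Real.exp (-(m - 1) / (s * Fintype.card ι))) := by
  refine ((σ.draw ι m).expect_mono fun Ω => indicator_not_determines_le Ω W).trans ?_
  cases σ with
  | withReplacement => exact h.expect_withReplacement_le hs hcard m
  | bernoulli =>
    refine (h.expect_bernoulli_le hs hcard hm).trans (ENNReal.ofReal_le_ofReal ?_)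
    gcongr
    linarith

/-- The mean of a binomial variable, by absorbing the factor `k + 1` into the binomial coefficient.
-/
theorem sum_pow_mul_pow_mul_card {q : ℝ≥0∞} (hq : q ≤ 1) :
    ∑ S : Finset ι, q ^ S.card * (1 - q) ^ (Fintype.card ι - S.card) * (S.card : ℝ≥0∞) =
      Fintype.card ι * q := by
  set D := Fintype.card ι with hD
  have h1 := Finset.sum_powerset_apply_card (x := (Finset.univ : Finset ι))
    (fun k => q ^ k * (1 - q) ^ (D - k) * (k : ℝ≥0∞))
  rw [Finset.powerset_univ, Finset.card_univ, ← hD] at h1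
  rw [h1, Finset.sum_range_succ']
  simp only [Nat.cast_zero, mul_zero, smul_zero, add_zero]
  rcases Nat.eq_zero_or_pos D with h0 | h0
  · simp [h0]
  clear_value D
  obtain ⟨d, rfl⟩ : ∃ d, D = d + 1 := ⟨D - 1, by omega⟩
  have h2 : ∀ k ∈ Finset.range (d + 1), (d + 1).choose (k + 1) •
      (q ^ (k + 1) * (1 - q) ^ (d + 1 - (k + 1)) * ((k + 1 : ℕ) : ℝ≥0∞)) =
      ((d + 1 : ℕ) : ℝ≥0∞) * q * (q ^ k * (1 - q) ^ (d - k) * d.choose k) := by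
    intro k _
    have h3 : ((d + 1 : ℕ) : ℝ≥0∞) * (d.choose k : ℝ≥0∞) =
        ((d + 1).choose (k + 1) : ℝ≥0∞) * ((k + 1 : ℕ) : ℝ≥0∞) := by
      exact_mod_cast Nat.add_one_mul_choose_eq d k
    rw [nsmul_eq_mul, Nat.add_sub_add_right]
    calc _ = q * q ^ k * (1 - q) ^ (d - k) *
          (((d + 1).choose (k + 1) : ℝ≥0∞) * ((k + 1 : ℕ) : ℝ≥0∞)) := by rw [pow_succ']; ring
      _ = _ := by rw [← h3]; ring
  rw [Finset.sum_congr rfl h2, ← Finset.mul_sum, ← add_pow, add_tsub_cancel_of_le hq, one_pow,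
    mul_one]

/-- The expected number of sampled positions is within the budget. -/
theorem SamplingScheme.expect_length_le (σ : SamplingScheme) (m : ℝ) :
    ((σ.draw ι m).expect fun Ω => (Ω.length : ℝ≥0∞)) ≤ ENNReal.ofReal m := by
  cases σ with
  | bernoulli =>
    rw [draw, PMF.expect_map, PMF.expect_fintype]
    simp only [randomSubset, PMF.ofFintype_apply, Finset.length_toList]
    rw [sum_pow_mul_pow_mul_card (min_le_left _ _)]
    rcases Nat.eq_zero_or_pos (Fintype.card ι) with h0 | h0
    · simp [h0]
    · have hD : (0 : ℝ) < Fintype.card ι := by exact_mod_cast h0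
      calc _ ≤ (Fintype.card ι : ℝ≥0∞) * ENNReal.ofReal (m / Fintype.card ι) := by
            gcongr
            exact min_le_right _ _
        _ = _ := by
            rw [← ENNReal.ofReal_natCast, ← ENNReal.ofReal_mul hD.le]
            congr 1
            field_simp
  | withReplacement =>
    have hfl : ((⌊m⌋₊ : ℕ) : ℝ≥0∞) ≤ ENNReal.ofReal m := by
      rw [← ENNReal.ofReal_natCast]
      rcases le_or_gt 0 m with hm | hm
      · exact ENNReal.ofReal_le_ofReal (Nat.floor_le hm)
      · simp [Nat.floor_of_nonpos hm.le]
    rw [draw, uniformDraws]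
    split_ifs with h
    · rw [PMF.expect_map]
      simpa [PMF.expect_const] using hfl
    · simp [PMF.expect_pure]

end Draw

/-! ### Projection test, reconstruction and growth of the basis -/

section Basis

variable {ι : Type} [Fintype ι]

theorem sampledSpan_eq_image {Ω : List ι} {U : List (EuclideanSpace ℝ ι)}
    {y : EuclideanSpace ℝ (Fin Ω.length)} :
    y ∈ sampledSpan Ω U ↔ ∃ v ∈ Submodule.span ℝ {u | u ∈ U}, subsample Ω v = y := by
  let f : EuclideanSpace ℝ ι →ₗ[ℝ] EuclideanSpace ℝ (Fin Ω.length) :=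
    { toFun := subsample Ω
      map_add' := fun v w => by ext p; simp [subsample]
      map_smul' := fun c v => by ext p; simp [subsample] }
  have h : sampledSpan Ω U = (Submodule.span ℝ {u | u ∈ U}).map f := by
    rw [Submodule.map_span, sampledSpan]
    congr 1
    ext w
    simp [f, eq_comm]
  rw [h, Submodule.mem_map]
  rfl

theorem informative_iff {Ω : List ι} {U : List (EuclideanSpace ℝ ι)}
    {y : EuclideanSpace ℝ (Fin Ω.length)} : Informative Ω U y ↔ y ∉ sampledSpan Ω U := by
  rw [Informative, ← Submodule.starProjection_eq_self_iff]
  constructor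
  · intro h h'
    rw [h'] at h
    simp at h
  · intro h
    have : y - (sampledSpan Ω U).starProjection y ≠ 0 := fun h' => h (sub_eq_zero.1 h').symm
    positivity

/-- A positive test is reliable for every sample and every basis. The cost bounds therefore need no
assumption on Ω; only a negative test relies on `Determines`. -/
theorem Informative.notMem_span {Ω : List ι} {U : List (EuclideanSpace ℝ ι)}
    {v : EuclideanSpace ℝ ι} (h : Informative Ω U (subsample Ω v)) :
    v ∉ Submodule.span ℝ {u | u ∈ U} := fun hv =>
  informative_iff.1 h (sampledSpan_eq_image.2 ⟨v, hv, rfl⟩)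

theorem Determines.eq_of_subsample_eq {Ω : List ι} {W : Submodule ℝ (EuclideanSpace ℝ ι)}
    (h : Determines Ω W) {v w : EuclideanSpace ℝ ι} (hv : v ∈ W) (hw : w ∈ W)
    (heq : subsample Ω v = subsample Ω w) : v = w := by
  refine sub_eq_zero.1 (h _ (W.sub_mem hv hw) fun x hx => ?_)
  obtain ⟨p, rfl⟩ := List.get_of_mem hx
  have := congrArg (fun z : EuclideanSpace ℝ (Fin Ω.length) => z p) heq
  simpa [subsample, sub_eq_zero] using this

theorem Determines.mem_span_of_not_informative {Ω : List ι}
    {W : Submodule ℝ (EuclideanSpace ℝ ι)} (h : Determines Ω W) {U : List (EuclideanSpace ℝ ι)}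
    (hU : ∀ u ∈ U, u ∈ W) {v : EuclideanSpace ℝ ι} (hv : v ∈ W)
    (hi : ¬ Informative Ω U (subsample Ω v)) : v ∈ Submodule.span ℝ {u | u ∈ U} := by
  rw [informative_iff, not_not, sampledSpan_eq_image] at hi
  obtain ⟨w, hw, heq⟩ := hi
  rwa [← h.eq_of_subsample_eq (Submodule.span_le.2 hU hw) hv heq]

/-- The members of `U` are nonzero and pairwise orthogonal. -/
def OrthogonalList (U : List (EuclideanSpace ℝ ι)) : Prop :=
  (∀ u ∈ U, u ≠ 0) ∧ U.Pairwise fun u v => inner ℝ u v = 0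

theorem OrthogonalList.linearIndependent {U : List (EuclideanSpace ℝ ι)}
    (h : OrthogonalList U) : LinearIndependent ℝ U.get := by
  refine linearIndependent_of_ne_zero_of_inner_eq_zero (𝕜 := ℝ)
    (fun i => h.1 _ (List.get_mem _ _)) fun i j hij => ?_
  rcases lt_or_gt_of_ne hij with hlt | hlt
  · exact h.2.rel_get_of_lt hlt
  · rw [real_inner_comm]
    exact h.2.rel_get_of_lt hlt

theorem Determines.reconstruct_subsample {Ω : List ι} {W : Submodule ℝ (EuclideanSpace ℝ ι)}
    (h : Determines Ω W) {U : List (EuclideanSpace ℝ ι)} (hU : ∀ u ∈ U, u ∈ W)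
    (hort : OrthogonalList U) {v : EuclideanSpace ℝ ι}
    (hv : v ∈ Submodule.span ℝ {u | u ∈ U}) : reconstruct Ω U (subsample Ω v) = v := by
  set A := sampledMatrix Ω U with hA
  have hcomb : ∀ c : Fin U.length → ℝ,
      A.mulVec c = (subsample Ω (∑ j, c j • U.get j)).ofLp := by
    intro c
    ext p
    simp [hA, sampledMatrix, subsample, Matrix.mulVec, dotProduct, mul_comm]
  have hinj : Function.Injective A.mulVec := by
    intro c c' hcc
    have hmem : ∀ c : Fin U.length → ℝ, ∑ j, c j • U.get j ∈ W := fun c =>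
      W.sum_mem fun j _ => W.smul_mem _ (hU _ (List.get_mem _ _))
    rw [hcomb, hcomb] at hcc
    have := h.eq_of_subsample_eq (hmem c) (hmem c') (WithLp.ofLp_injective 2 hcc)
    rw [← sub_eq_zero, ← Finset.sum_sub_distrib] at this
    simp only [← sub_smul] at this
    have h0 := Fintype.linearIndependent_iff.1 hort.linearIndependent _ this
    ext j
    exact sub_eq_zero.1 (h0 j)
  -- Sampling is injective on `W` and `U` is independent, so the sampled Gram matrix is positive
  -- definite and the matrix inverse is a true inverse rather than the default `0`.
  have hdet : IsUnit (A.transpose * A).det := by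
    have := (Matrix.PosDef.conjTranspose_mul_self A hinj).det_pos
    rw [Matrix.conjTranspose_eq_transpose_of_trivial] at this
    exact this.ne'.isUnit
  have hrange : {u | u ∈ U} = Set.range U.get := by
    rw [Set.range_list_get]
  rw [hrange, Submodule.mem_span_range_iff_exists_fun] at hv
  obtain ⟨c, rfl⟩ := hv
  have hfinal : (basisMatrix U * (A.transpose * A)⁻¹ * A.transpose).mulVec (A.mulVec c) =
      (basisMatrix U).mulVec c := by
    rw [Matrix.mulVec_mulVec, Matrix.mul_assoc, Matrix.mul_assoc, Matrix.nonsing_inv_mul _ hdet,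
      Matrix.mul_one]
  rw [reconstruct, ← hA, ← hcomb, hfinal]
  ext x
  simp [basisMatrix, Matrix.mulVec, dotProduct, mul_comm]

theorem span_le_span_extendBasis (U : List (EuclideanSpace ℝ ι)) (v : EuclideanSpace ℝ ι) :
    Submodule.span ℝ {u | u ∈ U} ≤ Submodule.span ℝ {u | u ∈ extendBasis U v} :=
  Submodule.span_mono fun u hu => by
    simp only [extendBasis, Set.mem_ofPred_eq, List.mem_append] at hu ⊢
    exact Or.inl hu

theorem orthogonal_starProjection_eq_zero_iff {V : Submodule ℝ (EuclideanSpace ℝ ι)}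
    {v : EuclideanSpace ℝ ι} : Vᗮ.starProjection v = 0 ↔ v ∈ V := by
  rw [Submodule.starProjection_apply_eq_zero_iff, Submodule.orthogonal_orthogonal]

theorem mem_span_extendBasis (U : List (EuclideanSpace ℝ ι)) (v : EuclideanSpace ℝ ι) :
    v ∈ Submodule.span ℝ {u | u ∈ extendBasis U v} := by
  set V := Submodule.span ℝ {u | u ∈ U} with hV
  set w := Vᗮ.starProjection v with hw
  -- If `w = 0`, the appended vector is `0`, but `v` already lies in the old span.
  rcases eq_or_ne w 0 with h0 | h0
  · exact span_le_span_extendBasis U v (orthogonal_starProjection_eq_zero_iff.1 h0)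
  have h1 : v = V.starProjection v + ‖w‖ • (‖w‖⁻¹ • w) := by
    rw [smul_inv_smul₀ (norm_ne_zero_iff.2 h0), hw,
      Submodule.starProjection_add_starProjection_orthogonal]
  have h2 : ‖w‖⁻¹ • w ∈ Submodule.span ℝ {u | u ∈ extendBasis U v} :=
    Submodule.subset_span (by simp [extendBasis, hw, hV])
  have h3 := Submodule.add_mem _
    (span_le_span_extendBasis U v (Submodule.starProjection_apply_mem V v))
    (Submodule.smul_mem _ ‖w‖ h2)
  rwa [← h1] at h3

theorem OrthogonalList.extendBasis {U : List (EuclideanSpace ℝ ι)} (h : OrthogonalList U)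
    {v : EuclideanSpace ℝ ι} (hv : v ∉ Submodule.span ℝ {u | u ∈ U}) :
    OrthogonalList (extendBasis U v) := by
  set w := (Submodule.span ℝ {u | u ∈ U})ᗮ.starProjection v with hw
  have h0 : w ≠ 0 := fun h0 => hv (orthogonal_starProjection_eq_zero_iff.1 h0)
  have hmem : w ∈ (Submodule.span ℝ {u | u ∈ U})ᗮ := Submodule.starProjection_apply_mem _ _
  refine ⟨fun u hu => ?_, ?_⟩
  · rcases List.mem_append.1 hu with hu | hu
    · exact h.1 u hu
    · rw [List.mem_singleton.1 hu]
      exact smul_ne_zero (inv_ne_zero (norm_ne_zero_iff.2 h0)) h0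
  · refine List.pairwise_append.2 ⟨h.2, List.pairwise_singleton _ _, fun u hu z hz => ?_⟩
    rw [List.mem_singleton.1 hz, inner_smul_right,
      (Submodule.mem_orthogonal _ _).1 hmem u (Submodule.subset_span hu), mul_zero]

theorem extendBasis_mem {W : Submodule ℝ (EuclideanSpace ℝ ι)} {U : List (EuclideanSpace ℝ ι)}
    (hU : ∀ u ∈ U, u ∈ W) {v : EuclideanSpace ℝ ι} (hv : v ∈ W) :
    ∀ u ∈ extendBasis U v, u ∈ W := by
  intro u hu
  rcases List.mem_append.1 hu with hu | hu
  · exact hU u hu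
  · rw [List.mem_singleton.1 hu]
    refine W.smul_mem _ ?_
    have := Submodule.starProjection_add_starProjection_orthogonal
      (K := Submodule.span ℝ {u | u ∈ U}) v
    rw [← eq_sub_iff_add_eq'] at this
    rw [this]
    exact W.sub_mem hv (Submodule.span_le.2 hU (Submodule.starProjection_apply_mem _ _))

/-- The number of dimensions of `W` that are missing in the span of `U`. -/
noncomputable def remainingDim (W : Submodule ℝ (EuclideanSpace ℝ ι))
    (U : List (EuclideanSpace ℝ ι)) : ℕ :=
  Module.finrank ℝ W - Module.finrank ℝ (W ⊓ Submodule.span ℝ {u | u ∈ U} : Submodule ℝ _)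

theorem remainingDim_extendBasis_le (W : Submodule ℝ (EuclideanSpace ℝ ι))
    (U : List (EuclideanSpace ℝ ι)) (v : EuclideanSpace ℝ ι) :
    remainingDim W (extendBasis U v) ≤ remainingDim W U :=
  Nat.sub_le_sub_left
    (Submodule.finrank_mono (inf_le_inf_left W (span_le_span_extendBasis U v))) _

/-- The new span contains `v`, a vector of `W` outside the old span. Counting only inside `W` keeps
this valid after a wrong completion has put vectors outside `W` into the basis. -/
theorem remainingDim_extendBasis_add_one_le {W : Submodule ℝ (EuclideanSpace ℝ ι)}
    {U : List (EuclideanSpace ℝ ι)} {v : EuclideanSpace ℝ ι} (hv : v ∈ W)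
    (hvU : v ∉ Submodule.span ℝ {u | u ∈ U}) :
    remainingDim W (extendBasis U v) + 1 ≤ remainingDim W U := by
  have h1 : Module.finrank ℝ (W ⊓ Submodule.span ℝ {u | u ∈ U} : Submodule ℝ _) <
      Module.finrank ℝ (W ⊓ Submodule.span ℝ {u | u ∈ extendBasis U v} : Submodule ℝ _) := by
    refine Submodule.finrank_lt_finrank_of_lt (lt_of_le_of_ne
      (inf_le_inf_left W (span_le_span_extendBasis U v)) fun h => hvU ?_)
    have : v ∈ W ⊓ Submodule.span ℝ {u | u ∈ extendBasis U v} := ⟨hv, mem_span_extendBasis U v⟩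
    rw [← h] at this
    exact this.2
  have h2 := Submodule.finrank_mono
    (inf_le_left : W ⊓ Submodule.span ℝ {u | u ∈ extendBasis U v} ≤ W)
  unfold remainingDim
  omega

end Basis

/-! ### Cost and failure probability of one sweep -/

section Sweep

variable {ι : Type} [Fintype ι] {k : ℕ}
  {complete : EuclideanSpace ℝ ι → PMF (EuclideanSpace ℝ ι × ℕ)} {Ω : List ι}
  {S : Fin k → EuclideanSpace ℝ ι} {W : Submodule ℝ (EuclideanSpace ℝ ι)}

open Classical in
-- A potential argument: `C'` pays for each missing dimension. A call costs `C` on average and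
-- releases one unit of `C'` unless it fails, which has probability at most `φ`; hence the condition
-- `C + φ * C' ≤ C'`.
theorem expect_sweep_cost_le (hS : ∀ i, S i ∈ W) {C φ C' : ℝ≥0∞}
    (hC : ∀ i, ((complete (S i)).expect fun o => (o.2 : ℝ≥0∞)) ≤ C)
    (hφ : ∀ i, ((complete (S i)).expect fun o => if o.1 = S i then 0 else 1) ≤ φ)
    (hC' : C + φ * C' ≤ C') (l : List (Fin k)) (s : SweepState ι k) :
    ((sweep complete Ω S l s).expect fun t => (t.cost : ℝ≥0∞)) ≤
      s.cost + l.length * Ω.length + remainingDim W s.basis * C' := by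
  induction l generalizing s with
  | nil => simp [sweep, PMF.expect_pure]
  | cons i l ih =>
    rw [sweep, PMF.expect_bind, sweepStep]
    split_ifs with hinf
    · rw [PMF.expect_map]
      have hdim := remainingDim_extendBasis_add_one_le (hS i) hinf.notMem_span
      obtain ⟨N, hN⟩ : ∃ N, remainingDim W s.basis = N + 1 := ⟨_, (Nat.succ_pred (by omega)).symm⟩
      have hout : ∀ o : EuclideanSpace ℝ ι × ℕ,
          (remainingDim W (extendBasis s.basis o.1) : ℝ≥0∞) ≤
            N + if o.1 = S i then 0 else 1 := by
        intro o
        split_ifs with ho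
        · rw [ho, add_zero]
          exact_mod_cast (by omega : remainingDim W (extendBasis s.basis (S i)) ≤ N)
        · have := remainingDim_extendBasis_le W s.basis o.1
          rw [hN] at this
          exact_mod_cast this
      refine ((complete (S i)).expect_mono
        (g := fun o => (s.cost + (l.length + 1) * Ω.length + N * C') +
          (o.2 + (if o.1 = S i then 0 else 1) * C')) fun o => ?_).trans ?_
      · refine (ih _).trans ?_
        calc _ ≤ ((s.cost + Ω.length + o.2 : ℕ) : ℝ≥0∞) + l.length * Ω.length +
              (N + if o.1 = S i then 0 else 1) * C' := by gcongr; exact hout o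
          _ = _ := by push_cast; ring
      · rw [PMF.expect_add, PMF.expect_const, PMF.expect_add, PMF.expect_mul_const]
        calc _ ≤ (s.cost + (l.length + 1) * Ω.length + N * C') + (C + φ * C') := by
              gcongr
              · exact hC i
              · exact hφ i
          _ ≤ (s.cost + (l.length + 1) * Ω.length + N * C') + C' := by gcongr
          _ = _ := by rw [hN, List.length_cons]; push_cast; ring
    · rw [PMF.expect_pure]
      refine (ih _).trans (le_of_eq ?_)
      push_cast [List.length_cons]
      ring

/-- A wrong estimate at an index that is not visited again is never repaired, so such runs
contribute nothing on the event of success. -/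
theorem expect_sweep_eq_zero {f : SweepState ι k → ℝ≥0∞} {i : Fin k}
    (hf : ∀ t, t.est i ≠ S i → f t = 0) (l : List (Fin k)) (hi : i ∉ l) (s : SweepState ι k)
    (hs : s.est i ≠ S i) : (sweep complete Ω S l s).expect f = 0 := by
  induction l generalizing s with
  | nil => rw [sweep, PMF.expect_pure, hf s hs]
  | cons j l ih =>
    rw [List.mem_cons, not_or] at hi
    rw [sweep, PMF.expect_bind, sweepStep]
    split_ifs
    · rw [PMF.expect_map]
      refine nonpos_iff_eq_zero.1 (((complete (S j)).expect_mono
        (g := fun _ => 0) fun o => le_of_eq (ih hi.2 _ ?_)).trans (PMF.expect_const _ _).le)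
      simpa [Function.update_of_ne hi.1] using hs
    · rw [PMF.expect_pure]
      refine ih hi.2 _ ?_
      simpa [Function.update_of_ne hi.1] using hs

open Classical in
-- Only runs whose calls are all correct count, and there each call uses up one missing dimension.
-- `Nodup` ensures that a wrong estimate is not overwritten later.
theorem expect_sweep_cost_on_success_le (hS : ∀ i, S i ∈ W) {C : ℝ≥0∞}
    (hC : ∀ i, ((complete (S i)).expect fun o => if o.1 = S i then (o.2 : ℝ≥0∞) else 0) ≤ C)
    (l : List (Fin k)) (hl : l.Nodup) (s : SweepState ι k) :
    ((sweep complete Ω S l s).expect fun t => if t.est = S then (t.cost : ℝ≥0∞) else 0) ≤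
      s.cost + l.length * Ω.length + remainingDim W s.basis * C := by
  induction l generalizing s with
  | nil =>
    rw [sweep, PMF.expect_pure]
    split_ifs
    · simp
    · exact zero_le
  | cons i l ih =>
    rw [List.nodup_cons] at hl
    rw [sweep, PMF.expect_bind, sweepStep]
    split_ifs with hinf
    · rw [PMF.expect_map]
      have hdim := remainingDim_extendBasis_add_one_le (hS i) hinf.notMem_span
      obtain ⟨N, hN⟩ : ∃ N, remainingDim W s.basis = N + 1 := ⟨_, (Nat.succ_pred (by omega)).symm⟩
      refine ((complete (S i)).expect_mono
        (g := fun o => (s.cost + (l.length + 1) * Ω.length + N * C) +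
          if o.1 = S i then (o.2 : ℝ≥0∞) else 0) fun o => ?_).trans ?_
      · split_ifs with ho
        · refine (ih hl.2 _).trans ?_
          have hle : (remainingDim W (extendBasis s.basis o.1) : ℝ≥0∞) ≤ N := by
            rw [ho]
            exact_mod_cast (by omega : remainingDim W (extendBasis s.basis (S i)) ≤ N)
          calc _ ≤ ((s.cost + Ω.length + o.2 : ℕ) : ℝ≥0∞) + l.length * Ω.length + N * C := by
                gcongr
            _ = _ := by push_cast; ring
        · refine le_of_eq_of_le (expect_sweep_eq_zero (i := i) (fun t ht => ?_) l hl.1 _ ?_)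
            zero_le
          · rw [if_neg]
            rintro rfl
            exact ht rfl
          · simpa using ho
      · rw [PMF.expect_add, PMF.expect_const]
        calc _ ≤ (s.cost + (l.length + 1) * Ω.length + N * C) + C := by
              gcongr
              exact hC i
          _ = _ := by rw [hN, List.length_cons]; push_cast; ring
    · rw [PMF.expect_pure]
      refine (ih hl.2 _).trans (le_of_eq ?_)
      push_cast [List.length_cons]
      ring

open Classical in
-- A union bound over the calls: while all of them succeed, the basis stays orthogonal and inside
-- `W`, reconstruction is exact, and each call uses up a missing dimension.
theorem Determines.expect_sweep_fail_le (hΩ : Determines Ω W) (hS : ∀ i, S i ∈ W) {φ : ℝ≥0∞}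
    (hφ : ∀ i, ((complete (S i)).expect fun o => if o.1 = S i then 0 else 1) ≤ φ)
    (l : List (Fin k)) (s : SweepState ι k) (hort : OrthogonalList s.basis)
    (hU : ∀ u ∈ s.basis, u ∈ W) (hest : ∀ j, j ∈ l ∨ s.est j = S j) :
    ((sweep complete Ω S l s).expect fun t => if t.est = S then 0 else 1) ≤
      remainingDim W s.basis * φ := by
  induction l generalizing s with
  | nil =>
    rw [sweep, PMF.expect_pure, if_pos (funext fun j => (hest j).resolve_left (by simp))]
    exact zero_le
  | cons i l ih =>
    have hest' : ∀ v, v = S i → ∀ j, j ∈ l ∨ Function.update s.est i v j = S j := by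
      rintro v rfl j
      rcases eq_or_ne j i with rfl | hji
      · simp
      · rw [Function.update_of_ne hji]
        refine (hest j).imp_left fun h => ?_
        rw [List.mem_cons] at h
        exact h.resolve_left hji
    rw [sweep, PMF.expect_bind, sweepStep]
    split_ifs with hinf
    · rw [PMF.expect_map]
      have hdim := remainingDim_extendBasis_add_one_le (hS i) hinf.notMem_span
      obtain ⟨N, hN⟩ : ∃ N, remainingDim W s.basis = N + 1 := ⟨_, (Nat.succ_pred (by omega)).symm⟩
      refine ((complete (S i)).expect_mono
        (g := fun o => N * φ + if o.1 = S i then 0 else 1) fun o => ?_).trans ?_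
      · split_ifs with ho
        · have hle : (remainingDim W (extendBasis s.basis o.1) : ℝ≥0∞) ≤ N := by
            rw [ho]
            exact_mod_cast (by omega : remainingDim W (extendBasis s.basis (S i)) ≤ N)
          refine (ih _ ?_ ?_ (hest' _ ho)).trans ?_
          · rw [ho]
            exact hort.extendBasis hinf.notMem_span
          · rw [ho]
            exact extendBasis_mem hU (hS i)
          · rw [add_zero]
            gcongr
        -- After a wrong call the failure probability is bounded by `1`; this case is charged to
        -- `φ`.
        · refine (PMF.expect_mono _ (g := fun _ => 1) fun t => ?_).trans ?_
          · split_ifs <;> simp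
          · rw [PMF.expect_const]
            exact le_add_self
      · rw [PMF.expect_add, PMF.expect_const, hN]
        push_cast
        rw [add_mul, one_mul]
        gcongr
        exact hφ i
    · rw [PMF.expect_pure]
      exact ih _ hort hU (hest' _ (hΩ.reconstruct_subsample hU hort
        (hΩ.mem_span_of_not_informative hU (hS i) hinf)))

end Sweep

/-! ### Spans of outer products, coherence and subtensors -/

section Tensor

/-- Spreads multiply over modes. Each fibre in mode `0` lies in the span of `a 0`, which yields the
factor `s 0`; the remaining modes follow by induction, with the values `a 0 k (x 0)` absorbed into
the coefficients `c`. -/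
theorem sq_sum_mul_prod_le {T r : ℕ} {n : Fin T → ℕ}
    (a : (t : Fin T) → Fin r → EuclideanSpace ℝ (Fin (n t))) {s : Fin T → ℝ}
    (hs : ∀ t, 0 ≤ s t) (ha : ∀ t, Spread (Submodule.span ℝ (Set.range (a t))) (s t))
    (c : Fin r → ℝ) (x : TIdx n) :
    (∑ k, c k * ∏ t, a t k (x t)) ^ 2 ≤
      (∏ t, s t) * ∑ y : TIdx n, (∑ k, c k * ∏ t, a t k (y t)) ^ 2 := by
  induction T generalizing c with
  | zero => simp
  | succ T ih =>
    have hfib : ∀ y : TIdx fun t : Fin T => n t.succ,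
        (∑ k, c k * a 0 k (x 0) * ∏ t, a (Fin.succ t) k (y t)) ^ 2 ≤
          s 0 * ∑ z, (∑ k, c k * a 0 k z * ∏ t, a (Fin.succ t) k (y t)) ^ 2 := by
      intro y
      let v : EuclideanSpace ℝ (Fin (n 0)) := ∑ k, (c k * ∏ t, a (Fin.succ t) k (y t)) • a 0 k
      have hv : v ∈ Submodule.span ℝ (Set.range (a 0)) :=
        Submodule.sum_mem _ fun k _ =>
          Submodule.smul_mem _ _ (Submodule.subset_span (Set.mem_range_self k))
      have hvz : ∀ z, v z = ∑ k, c k * a 0 k z * ∏ t, a (Fin.succ t) k (y t) := by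
        intro z
        simp only [v, WithLp.ofLp_sum, WithLp.ofLp_smul, Finset.sum_apply, Pi.smul_apply,
          smul_eq_mul]
        exact Finset.sum_congr rfl fun k _ => by ring
      have := ha 0 v hv (x 0)
      rw [EuclideanSpace.real_norm_sq_eq] at this
      simpa only [hvz] using this
    have hih := ih (fun t => a t.succ) (fun t => hs t.succ) (fun t => ha t.succ)
      (fun k => c k * a 0 k (x 0)) fun t => x t.succ
    rw [← (Fin.consEquiv fun t => Fin (n t)).sum_comp, Fintype.sum_prod_type_right]
    simp only [Fin.prod_univ_succ, Fin.consEquiv_apply, Fin.cons_zero, Fin.cons_succ, ← mul_assoc]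
    refine hih.trans ?_
    rw [mul_comm (s 0), mul_assoc, Finset.mul_sum (a := s 0)]
    exact mul_le_mul_of_nonneg_left (Finset.sum_le_sum fun y _ => hfib y)
      (Finset.prod_nonneg fun t _ => hs t.succ)

/-- The span of the outer products `a 0 k ⊗ ⋯ ⊗ a (T-1) k`. -/
def outerSpan {T r : ℕ} {n : Fin T → ℕ}
    (a : (t : Fin T) → Fin r → EuclideanSpace ℝ (Fin (n t))) : Submodule ℝ (Tensor n) :=
  Submodule.span ℝ (Set.range fun k => WithLp.toLp 2 fun x => ∏ t, a t k (x t))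

variable {T r : ℕ} {n : Fin T → ℕ} {a : (t : Fin T) → Fin r → EuclideanSpace ℝ (Fin (n t))}

theorem mem_outerSpan_iff {w : Tensor n} :
    w ∈ outerSpan a ↔ ∃ c : Fin r → ℝ, ∀ x, w x = ∑ k, c k * ∏ t, a t k (x t) := by
  rw [outerSpan, Submodule.mem_span_range_iff_exists_fun]
  refine exists_congr fun c => ?_
  constructor
  · rintro rfl x
    simp
  · intro h
    ext x
    simp [h]

theorem finrank_outerSpan_le : Module.finrank ℝ (outerSpan a) ≤ r :=
  (finrank_range_le_card _).trans (Fintype.card_fin r).le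

theorem spread_outerSpan {s : Fin T → ℝ} (hs : ∀ t, 0 ≤ s t)
    (ha : ∀ t, Spread (Submodule.span ℝ (Set.range (a t))) (s t)) :
    Spread (outerSpan a) (∏ t, s t) := by
  intro w hw x
  obtain ⟨c, hc⟩ := mem_outerSpan_iff.1 hw
  rw [EuclideanSpace.real_norm_sq_eq]
  simp only [hc]
  exact sq_sum_mul_prod_le a hs ha c x

/-- For `w` in `U`, the entry `w x` is the inner product of `w` with the projection of the basis
vector at `x`; Cauchy–Schwarz does the rest. -/
theorem spread_of_coherence_le {N : ℕ} {U : Submodule ℝ (EuclideanSpace ℝ (Fin N))} {μ : ℝ}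
    (hN : 0 < N) (hU : 0 < Module.finrank ℝ U) (h : coherence U ≤ μ) :
    Spread U (μ * Module.finrank ℝ U / N) := by
  intro w hw x
  have hN' : (0 : ℝ) < N := by exact_mod_cast hN
  have hU' : (0 : ℝ) < Module.finrank ℝ U := by exact_mod_cast hU
  have h1 : ‖U.starProjection (EuclideanSpace.single x (1 : ℝ))‖ ^ 2 ≤
      μ * Module.finrank ℝ U / N := by
    have h2 : ‖U.starProjection (EuclideanSpace.single x (1 : ℝ))‖ ^ 2 ≤
        ⨆ j : Fin N, ‖U.starProjection (EuclideanSpace.single j (1 : ℝ))‖ ^ 2 :=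
      le_ciSup (f := fun j : Fin N => ‖U.starProjection (EuclideanSpace.single j (1 : ℝ))‖ ^ 2)
        (Set.finite_range _).bddAbove x
    rw [le_div_iff₀ hN', ← div_le_iff₀ hU']
    refine le_trans (le_of_eq ?_) ((mul_le_mul_of_nonneg_left h2 (by positivity)).trans h)
    ring
  have h3 : w x = inner ℝ w (U.starProjection (EuclideanSpace.single x (1 : ℝ))) := by
    rw [← Submodule.inner_starProjection_left_eq_right,
      Submodule.starProjection_eq_self_iff.2 hw, EuclideanSpace.inner_single_right]
    simp
  calc w x ^ 2 ≤ (‖w‖ * ‖U.starProjection (EuclideanSpace.single x (1 : ℝ))‖) ^ 2 := by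
        rw [h3]
        exact sq_le_sq' (neg_le_of_abs_le (abs_real_inner_le_norm _ _)) (real_inner_le_norm _ _)
    _ = ‖U.starProjection (EuclideanSpace.single x (1 : ℝ))‖ ^ 2 * ‖w‖ ^ 2 := by ring
    _ ≤ _ := mul_le_mul_of_nonneg_right h1 (sq_nonneg _)

theorem coherence_nonneg {N : ℕ} (U : Submodule ℝ (EuclideanSpace ℝ (Fin N))) :
    0 ≤ coherence U :=
  mul_nonneg (by positivity) (Real.iSup_nonneg fun _ => sq_nonneg _)

/-- The trace bound `Spread.finrank_le` with at most `N` positions gives `dim U ≤ μ * dim U`. -/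
theorem one_le_of_coherence_le {N : ℕ} {U : Submodule ℝ (EuclideanSpace ℝ (Fin N))} {μ : ℝ}
    (hN : 0 < N) (hU : 0 < Module.finrank ℝ U) (h : coherence U ≤ μ) : 1 ≤ μ := by
  classical
  have hN' : (0 : ℝ) < N := by exact_mod_cast hN
  have hU' : (0 : ℝ) < Module.finrank ℝ U := by exact_mod_cast hU
  have hμ : 0 ≤ μ := (coherence_nonneg U).trans h
  have h1 := (spread_of_coherence_le hN hU h).finrank_le (by positivity)
  have h2 : ((Finset.univ.filter fun x => ∃ w ∈ U, w x ≠ 0).card : ℝ) ≤ N := by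
    exact_mod_cast (Finset.card_le_univ _).trans (Fintype.card_fin N).le
  have h3 := h1.trans (mul_le_mul_of_nonneg_left h2 (by positivity))
  rw [div_mul_cancel₀ _ hN'.ne'] at h3
  exact le_of_mul_le_mul_right (by linarith) hU'

/-- Subtensors use the same outer products and differ only in their coefficients. This is why the
inductions below run over arbitrary coefficients `c`. -/
theorem lastSlice_apply_eq {T : ℕ} {n : Fin (T + 1) → ℕ}
    {a : (t : Fin (T + 1)) → Fin r → EuclideanSpace ℝ (Fin (n t))} {c : Fin r → ℝ} {M : Tensor n}
    (hM : ∀ x, M x = ∑ k, c k * ∏ t, a t k (x t)) (i : Fin (n (Fin.last T)))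
    (x : TIdx (initDims n)) :
    lastSlice M i x =
      ∑ k, (c k * a (Fin.last T) k i) * ∏ t : Fin T, a t.castSucc k (x t) := by
  simp only [lastSlice, hM, Fin.prod_univ_castSucc, Fin.snoc_castSucc, Fin.snoc_last]
  exact Finset.sum_congr rfl fun k _ => by ring

theorem ofLastSlices_eq_iff {T : ℕ} {n : Fin (T + 1) → ℕ}
    {S : Fin (n (Fin.last T)) → Tensor (initDims n)} {M : Tensor n} :
    ofLastSlices S = M ↔ S = lastSlice M := by
  constructor
  · rintro rfl
    ext i x
    simp [lastSlice, ofLastSlices]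
  · rintro rfl
    ext x
    simp only [lastSlice, ofLastSlices]
    exact congrArg M (Fin.snoc_init_self x)

theorem exists_ne_zero_of_tensorRank_pos {M : Tensor n} (h : 0 < tensorRank M) :
    ∃ x, M x ≠ 0 := by
  by_contra! h0
  refine h.ne' (Nat.sInf_eq_zero.2 (Or.inl ⟨fun _ k => k.elim0, ?_⟩))
  ext x
  simp [cpTensor, h0]

end Tensor

/-! ### Arithmetic of the budgets -/

section Budget

variable {r : ℕ} {μ₀ δ : ℝ}

theorem budget_one : budget r μ₀ δ 1 = 36 * √r * Real.log (2 * r / δ) := by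
  rw [budget, Real.sqrt_eq_rpow]
  norm_num

theorem budget_add_two (hr : 1 ≤ r) (t : ℕ) :
    budget r μ₀ δ (t + 2) = r * μ₀ * budget r μ₀ δ (t + 1) := by
  have hr0 : (0 : ℝ) < r := by exact_mod_cast hr
  have h : (r : ℝ) ^ (((t + 2 : ℕ) : ℝ) - 1 / 2) = r ^ (((t + 1 : ℕ) : ℝ) - 1 / 2) * r := by
    rw [← Real.rpow_add_one hr0.ne']
    congr 1
    push_cast
    ring
  rw [budget, budget, h, show t + 2 - 1 = t + 1 from rfl, show t + 1 - 1 = t from rfl, pow_succ]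
  ring

theorem budget_succ (hr : 1 ≤ r) (t : ℕ) :
    budget r μ₀ δ (t + 1) = (r * μ₀) ^ t * budget r μ₀ δ 1 := by
  induction t with
  | zero => simp
  | succ t ih => rw [budget_add_two hr, ih, pow_succ]; ring

theorem half_le_log (hr : 1 ≤ r) (hδ₀ : 0 < δ) (hδ₁ : δ < 1) :
    1 / 2 ≤ Real.log (2 * r / δ) := by
  have hr1 : (1 : ℝ) ≤ r := by exact_mod_cast hr
  have : (2 : ℝ) ≤ 2 * r / δ := by
    rw [le_div_iff₀ hδ₀]
    nlinarith
  have h2 := Real.log_le_log (by norm_num) this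
  linarith [Real.log_two_gt_d9]

theorem log_le_budget_one (hr : 1 ≤ r) (hδ₀ : 0 < δ) (hδ₁ : δ < 1) :
    36 * Real.log (2 * r / δ) ≤ budget r μ₀ δ 1 := by
  have hr1 : (1 : ℝ) ≤ √r := Real.one_le_sqrt.2 (by exact_mod_cast hr)
  have := half_le_log hr hδ₀ hδ₁
  rw [budget_one]
  nlinarith

theorem one_le_budget_one (hr : 1 ≤ r) (hδ₀ : 0 < δ) (hδ₁ : δ < 1) :
    1 ≤ budget r μ₀ δ 1 := by
  have := half_le_log hr hδ₀ hδ₁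
  linarith [log_le_budget_one (μ₀ := μ₀) hr hδ₀ hδ₁]

/-- With `L = log (2r/δ) ≥ 1/2`, the constant `36` leaves room for `1 - 36 L ≤ -2 L`, and `r * exp
(-2 L) = δ² / (4 r)`. -/
theorem mul_exp_one_sub_budget_one_le (hr : 1 ≤ r) (hδ₀ : 0 < δ) (hδ₁ : δ < 1) :
    r * Real.exp (1 - budget r μ₀ δ 1) ≤ δ ^ 2 := by
  have hr1 : (1 : ℝ) ≤ r := by exact_mod_cast hr
  have hr0 : (0 : ℝ) < r := by linarith
  have h1 := half_le_log hr hδ₀ hδ₁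
  have h2 : 1 - budget r μ₀ δ 1 ≤ (2 : ℕ) * -Real.log (2 * r / δ) := by
    push_cast
    linarith [log_le_budget_one (μ₀ := μ₀) hr hδ₀ hδ₁]
  calc _ ≤ r * Real.exp ((2 : ℕ) * -Real.log (2 * r / δ)) := by gcongr
    _ = δ ^ 2 / (4 * r) := by
      rw [Real.exp_nat_mul, Real.exp_neg, Real.exp_log (by positivity)]
      field_simp
      ring
    _ ≤ δ ^ 2 := div_le_self (sq_nonneg _) (by linarith)

end Budget

/-! ### Recursion over the order: failure probability and expected cost -/

section Completion

variable {r : ℕ} {μ₀ δ : ℝ}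

theorem initDims_pos {T : ℕ} {n : Fin (T + 1) → ℕ} (hn : ∀ t, 0 < n t) (t : Fin T) :
    0 < initDims n t := hn t.castSucc

open Classical in
theorem expect_draw_not_determines_outerSpan_le (σ : SamplingScheme) (hr : 1 ≤ r) (hδ₀ : 0 < δ)
    (hδ₁ : δ < 1) (hμ : 1 ≤ μ₀) {T : ℕ} {n : Fin T → ℕ} (hn : ∀ t, 0 < n t)
    {a : (t : Fin T) → Fin r → EuclideanSpace ℝ (Fin (n t))}
    (ha : ∀ t, Spread (Submodule.span ℝ (Set.range (a t))) (r * μ₀ / n t)) :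
    ((σ.draw (TIdx n) (budget r μ₀ δ (T + 1))).expect
        fun Ω => if Determines Ω (outerSpan a) then 0 else 1) ≤ ENNReal.ofReal (δ ^ 2) := by
  have hr1 : (1 : ℝ) ≤ r := by exact_mod_cast hr
  have hn' : ∀ t, (0 : ℝ) < n t := fun t => by exact_mod_cast hn t
  have hrμ : 1 ≤ r * μ₀ := one_le_mul_of_one_le_of_one_le hr1 hμ
  have hs : ∀ t, 0 < r * μ₀ / n t := fun t => div_pos (by linarith) (hn' t)
  have hK : (∏ t, r * μ₀ / (n t : ℝ)) * Fintype.card (TIdx n) = (r * μ₀) ^ T := by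
    have hprod : (∏ t, (n t : ℝ)) ≠ 0 := Finset.prod_ne_zero_iff.2 fun t _ => (hn' t).ne'
    simp only [Finset.prod_div_distrib, Fintype.card_pi, Fintype.card_fin, Nat.cast_prod]
    rw [div_mul_cancel₀ _ hprod]
    simp
  have hK1 : 1 ≤ (r * μ₀) ^ T := one_le_pow₀ hrμ
  have hb := one_le_budget_one (μ₀ := μ₀) hr hδ₀ hδ₁
  have hm : budget r μ₀ δ (T + 1) = (r * μ₀) ^ T * budget r μ₀ δ 1 := budget_succ hr T
  refine ((spread_outerSpan (fun t => (hs t).le) ha).expect_not_determines_le σ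
    (Finset.prod_pos fun t _ => hs t) (by rw [hK]; exact hK1)
    (by rw [hm]; positivity)).trans (ENNReal.ofReal_le_ofReal ?_)
  refine le_trans ?_ (mul_exp_one_sub_budget_one_le (μ₀ := μ₀) hr hδ₀ hδ₁)
  have hd : (Module.finrank ℝ (outerSpan a) : ℝ) ≤ r := by exact_mod_cast finrank_outerSpan_le
  -- The budget is `(r μ₀)^T` times the order-one budget, and the `1` lost to rounding is divided by
  -- `(r μ₀)^T ≥ 1`.
  have hexp : -(budget r μ₀ δ (T + 1) - 1) / ((r * μ₀) ^ T) ≤ 1 - budget r μ₀ δ 1 := by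
    rw [hm, div_le_iff₀ (by linarith)]
    nlinarith
  rw [hK]
  gcongr

open Classical in
-- The recursion is `p (T + 1) ≤ δ² + r * p T`, with `p 1 = 0`. The square of `δ` matters for the
-- cost: it keeps the failure probability of a call below `5δ`, independently of `T` and `r`,
-- whenever `5 δ T r^T < 1`.
theorem expect_tensorCompletion_ne_le (σ : SamplingScheme) (hr : 1 ≤ r) (hδ₀ : 0 < δ)
    (hδ₁ : δ < 1) (T : ℕ) (hμ : T ≠ 0 → 1 ≤ μ₀) (n : Fin (T + 1) → ℕ) (hn : ∀ t, 0 < n t)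
    (a : (t : Fin (T + 1)) → Fin r → EuclideanSpace ℝ (Fin (n t)))
    (ha : ∀ t : Fin T, Spread (Submodule.span ℝ (Set.range (a t.castSucc)))
      (r * μ₀ / n t.castSucc))
    (c : Fin r → ℝ) (M : Tensor n) (hM : ∀ x, M x = ∑ k, c k * ∏ t, a t k (x t)) :
    ((tensorCompletion σ (budget r μ₀ δ) (T + 1) n M).expect
        fun o => if o.1 = M then 0 else 1) ≤
      ENNReal.ofReal (δ ^ 2 * (T + 1 : ℕ) * (r : ℝ) ^ (T + 1)) := by
  induction T generalizing c with
  | zero => simp [tensorCompletion, PMF.expect_pure]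
  | succ T ih =>
    have hr1 : (1 : ℝ) ≤ r := by exact_mod_cast hr
    set φ := ENNReal.ofReal (δ ^ 2 * (T + 1 : ℕ) * (r : ℝ) ^ (T + 1)) with hφ
    have hcall : ∀ i, ((tensorCompletion σ (budget r μ₀ δ) (T + 1) (initDims n)
        (lastSlice M i)).expect fun o => if o.1 = lastSlice M i then 0 else 1) ≤ φ := fun i =>
      ih (fun _ => hμ T.succ_ne_zero) (initDims n) (initDims_pos hn) (fun t => a t.castSucc)
        (fun t => ha t.castSucc) _ _ (lastSlice_apply_eq hM i)
    have hmem : ∀ i, lastSlice M i ∈ outerSpan fun t : Fin (T + 1) => a t.castSucc := fun i =>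
      mem_outerSpan_iff.2 ⟨_, lastSlice_apply_eq hM i⟩
    rw [tensorCompletion, PMF.expect_bind]
    simp only [PMF.expect_map, ofLastSlices_eq_iff]
    refine (PMF.expect_mono _ (g := fun Ω => r * φ +
      if Determines Ω (outerSpan fun t : Fin (T + 1) => a t.castSucc) then 0 else 1)
      fun Ω => ?_).trans ?_
    · split_ifs with hΩ
      · rw [add_zero]
        refine (hΩ.expect_sweep_fail_le hmem hcall _ _ ⟨by simp, List.Pairwise.nil⟩ (by simp)
          fun j => Or.inl (List.mem_finRange j)).trans ?_
        gcongr
        exact (Nat.sub_le _ _).trans finrank_outerSpan_le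
      · refine (PMF.expect_mono _ (g := fun _ => 1) fun t => ?_).trans ?_
        · split_ifs <;> simp
        · rw [PMF.expect_const]
          exact le_add_self
    · rw [PMF.expect_add, PMF.expect_const]
      have hdraw := expect_draw_not_determines_outerSpan_le σ hr hδ₀ hδ₁ (hμ T.succ_ne_zero)
        (initDims_pos hn) (a := fun t : Fin (T + 1) => a t.castSucc) ha
      refine (add_le_add_right hdraw _).trans ?_
      rw [hφ, ← ENNReal.ofReal_natCast r, ← ENNReal.ofReal_mul (by positivity),
        ← ENNReal.ofReal_add (by positivity) (by positivity)]
      refine ENNReal.ofReal_le_ofReal ?_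
      have hpow : 1 ≤ (r : ℝ) ^ (T + 1 + 1) := one_le_pow₀ hr1
      have h1 : δ ^ 2 * 1 ≤ δ ^ 2 * (r : ℝ) ^ (T + 1 + 1) := by gcongr
      have h2 : (r : ℝ) * (δ ^ 2 * (T + 1 : ℕ) * (r : ℝ) ^ (T + 1)) =
          δ ^ 2 * (T + 1 : ℕ) * (r : ℝ) ^ (T + 1 + 1) := by ring
      rw [h2]
      push_cast
      linarith

theorem sum_castSucc_initDims {T : ℕ} (n : Fin (T + 1) → ℕ) :
    ∑ t, (n t : ℝ) = ∑ t, (initDims n t : ℝ) + n (Fin.last T) := Fin.sum_univ_castSucc _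

open Classical in
theorem expect_tensorCompletion_cost_on_success_le (σ : SamplingScheme) (hr : 1 ≤ r)
    (hδ₀ : 0 < δ) (hδ₁ : δ < 1) (T : ℕ) (hμ : T ≠ 0 → 1 ≤ μ₀) (n : Fin (T + 1) → ℕ)
    (a : (t : Fin (T + 1)) → Fin r → EuclideanSpace ℝ (Fin (n t)))
    (c : Fin r → ℝ) (M : Tensor n) (hM : ∀ x, M x = ∑ k, c k * ∏ t, a t k (x t)) :
    ((tensorCompletion σ (budget r μ₀ δ) (T + 1) n M).expect
        fun o => if o.1 = M then (o.2 : ℝ≥0∞) else 0) ≤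
      ENNReal.ofReal (budget r μ₀ δ (T + 1) * ∑ t, (n t : ℝ)) := by
  have hb := one_le_budget_one (μ₀ := μ₀) hr hδ₀ hδ₁
  induction T generalizing c with
  | zero =>
    rw [tensorCompletion, PMF.expect_pure, if_pos rfl, ← ENNReal.ofReal_natCast]
    refine ENNReal.ofReal_le_ofReal ?_
    simpa using mul_le_mul_of_nonneg_right hb (Nat.cast_nonneg (α := ℝ) (n 0))
  | succ T ih =>
    have hμ1 := hμ T.succ_ne_zero
    set C := ENNReal.ofReal (budget r μ₀ δ (T + 1) * ∑ t, (initDims n t : ℝ)) with hC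
    have hcall : ∀ i, ((tensorCompletion σ (budget r μ₀ δ) (T + 1) (initDims n)
        (lastSlice M i)).expect fun o => if o.1 = lastSlice M i then (o.2 : ℝ≥0∞) else 0) ≤ C :=
      fun i => ih (fun _ => hμ1) (initDims n) (fun t => a t.castSucc) _ _ (lastSlice_apply_eq hM i)
    have hmem : ∀ i, lastSlice M i ∈ outerSpan fun t : Fin (T + 1) => a t.castSucc := fun i =>
      mem_outerSpan_iff.2 ⟨_, lastSlice_apply_eq hM i⟩
    rw [tensorCompletion, PMF.expect_bind]
    simp only [PMF.expect_map, ofLastSlices_eq_iff]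
    refine (PMF.expect_mono _ (g := fun Ω => (n (Fin.last (T + 1)) : ℝ≥0∞) * Ω.length + r * C)
      fun Ω => ?_).trans ?_
    · refine (expect_sweep_cost_on_success_le hmem hcall _ (List.nodup_finRange _) _).trans ?_
      rw [Nat.cast_zero, zero_add, List.length_finRange]
      gcongr
      exact (Nat.sub_le _ _).trans finrank_outerSpan_le
    · rw [PMF.expect_add, PMF.expect_const, PMF.expect_const_mul]
      refine (add_le_add_left (mul_le_mul_right (σ.expect_length_le _) _) _).trans ?_
      have hm : 0 ≤ budget r μ₀ δ (T + 1) := by rw [budget_succ hr]; positivity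
      rw [hC, ← ENNReal.ofReal_natCast r, ← ENNReal.ofReal_natCast (n _),
        ← ENNReal.ofReal_mul (by positivity), ← ENNReal.ofReal_mul (by positivity),
        ← ENNReal.ofReal_add (mul_nonneg (by positivity) (by rw [budget_succ hr]; positivity))
          (by positivity), sum_castSucc_initDims n, budget_add_two hr]
      refine ENNReal.ofReal_le_ofReal ?_
      -- The recursive calls cost `r` times the lower-order bound, while the budget grows by `r μ₀`;
      -- the slack is `μ₀ ≥ 1`.
      have h1 : r * budget r μ₀ δ (T + 1) * (∑ t, (initDims n t : ℝ)) * 1 ≤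
          r * budget r μ₀ δ (T + 1) * (∑ t, (initDims n t : ℝ)) * μ₀ :=
        mul_le_mul_of_nonneg_left hμ1 (by positivity)
      linarith

/-- Each order above the first loses a factor `1 / (1 - 5δ)`, the mean number of attempts per
missing dimension when a call fails with probability `5δ`. -/
theorem expect_tensorCompletion_cost_le (σ : SamplingScheme) (hr : 1 ≤ r) (hδ₀ : 0 < δ)
    (hδ₁ : δ < 1) (T : ℕ) (hT : 5 * δ * (T + 1 : ℕ) * (r : ℝ) ^ (T + 1) < 1)
    (hμ : T ≠ 0 → 1 ≤ μ₀) (n : Fin (T + 1) → ℕ) (hn : ∀ t, 0 < n t)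
    (a : (t : Fin (T + 1)) → Fin r → EuclideanSpace ℝ (Fin (n t)))
    (ha : ∀ t : Fin T, Spread (Submodule.span ℝ (Set.range (a t.castSucc)))
      (r * μ₀ / n t.castSucc))
    (c : Fin r → ℝ) (M : Tensor n) (hM : ∀ x, M x = ∑ k, c k * ∏ t, a t k (x t)) :
    ((tensorCompletion σ (budget r μ₀ δ) (T + 1) n M).expect fun o => (o.2 : ℝ≥0∞)) ≤
      ENNReal.ofReal (budget r μ₀ δ (T + 1) * (∑ t, (n t : ℝ)) / (1 - 5 * δ) ^ T) := by
  classical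
  have hb := one_le_budget_one (μ₀ := μ₀) hr hδ₀ hδ₁
  have hr1 : (1 : ℝ) ≤ r := by exact_mod_cast hr
  have hδ5 : 0 < 1 - 5 * δ := by
    have h1 : (1 : ℝ) ≤ (T + 1 : ℕ) * (r : ℝ) ^ (T + 1) :=
      one_le_mul_of_one_le_of_one_le (by push_cast; linarith [Nat.cast_nonneg (α := ℝ) T])
        (one_le_pow₀ hr1)
    nlinarith
  induction T generalizing c with
  | zero =>
    rw [tensorCompletion, PMF.expect_pure, ← ENNReal.ofReal_natCast]
    refine ENNReal.ofReal_le_ofReal ?_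
    simpa using mul_le_mul_of_nonneg_right hb (Nat.cast_nonneg (α := ℝ) (n 0))
  | succ T ih =>
    have hμ1 := hμ T.succ_ne_zero
    have hT' : 5 * δ * (T + 1 : ℕ) * (r : ℝ) ^ (T + 1) < 1 := by
      refine lt_of_le_of_lt ?_ hT
      gcongr <;> first | exact hr1 | omega
    set x : ℝ := budget r μ₀ δ (T + 1) * ∑ t, (initDims n t : ℝ) with hx
    have hm : 0 ≤ budget r μ₀ δ (T + 1) := by rw [budget_succ hr]; positivity
    have hx0 : 0 ≤ x := by positivity
    set C := ENNReal.ofReal (x / (1 - 5 * δ) ^ T) with hC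
    set C' := ENNReal.ofReal (x / (1 - 5 * δ) ^ (T + 1)) with hC'
    have hcall : ∀ i, ((tensorCompletion σ (budget r μ₀ δ) (T + 1) (initDims n)
        (lastSlice M i)).expect fun o => (o.2 : ℝ≥0∞)) ≤ C := fun i =>
      ih hT' (fun _ => hμ1) (initDims n) (initDims_pos hn) (fun t => a t.castSucc)
        (fun t => ha t.castSucc) _ _ (lastSlice_apply_eq hM i)
    have hfail : ∀ i, ((tensorCompletion σ (budget r μ₀ δ) (T + 1) (initDims n)
        (lastSlice M i)).expect fun o => if o.1 = lastSlice M i then 0 else 1) ≤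
        ENNReal.ofReal (5 * δ) := fun i => by
      refine (expect_tensorCompletion_ne_le σ hr hδ₀ hδ₁ T (fun _ => hμ1) (initDims n)
        (initDims_pos hn) (fun t => a t.castSucc) (fun t => ha t.castSucc) _ _
        (lastSlice_apply_eq hM i)).trans (ENNReal.ofReal_le_ofReal ?_)
      -- By `hT'`, one factor `δ` times `(T + 1) r^(T+1)` is below `1/5`; the other factor `δ`
      -- remains.
      nlinarith
    have hmem : ∀ i, lastSlice M i ∈ outerSpan fun t : Fin (T + 1) => a t.castSucc := fun i =>
      mem_outerSpan_iff.2 ⟨_, lastSlice_apply_eq hM i⟩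
    -- `C' = C / (1 - 5δ)` is the fixed point of the potential condition.
    have hCC' : C + ENNReal.ofReal (5 * δ) * C' ≤ C' := by
      rw [hC, hC', ← ENNReal.ofReal_mul (by positivity),
        ← ENNReal.ofReal_add (by positivity) (by positivity)]
      refine ENNReal.ofReal_le_ofReal (le_of_eq ?_)
      field_simp
      ring
    rw [tensorCompletion, PMF.expect_bind]
    simp only [PMF.expect_map]
    refine (PMF.expect_mono _ (g := fun Ω => (n (Fin.last (T + 1)) : ℝ≥0∞) * Ω.length + r * C')
      fun Ω => ?_).trans ?_
    · refine (expect_sweep_cost_le hmem hcall hfail hCC' _ _).trans ?_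
      rw [Nat.cast_zero, zero_add, List.length_finRange]
      gcongr
      exact (Nat.sub_le _ _).trans finrank_outerSpan_le
    · rw [PMF.expect_add, PMF.expect_const, PMF.expect_const_mul]
      refine (add_le_add_left (mul_le_mul_right (σ.expect_length_le _) _) _).trans ?_
      rw [hC', ← ENNReal.ofReal_natCast r, ← ENNReal.ofReal_natCast (n _),
        ← ENNReal.ofReal_mul (by positivity), ← ENNReal.ofReal_mul (by positivity),
        ← ENNReal.ofReal_add (mul_nonneg (by positivity) (by rw [budget_succ hr]; positivity))
          (by positivity), sum_castSucc_initDims n, budget_add_two hr]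
      refine ENNReal.ofReal_le_ofReal ?_
      have hp : 0 < (1 - 5 * δ) ^ (T + 1) := by positivity
      have hp1 : (1 - 5 * δ) ^ (T + 1) ≤ 1 := pow_le_one₀ hδ5.le (by linarith)
      have h1 : r * x * 1 ≤ r * x * μ₀ := mul_le_mul_of_nonneg_left hμ1 (by positivity)
      have h2 : n (Fin.last (T + 1)) * (r * μ₀ * budget r μ₀ δ (T + 1)) *
          (1 - 5 * δ) ^ (T + 1) ≤ n (Fin.last (T + 1)) * (r * μ₀ * budget r μ₀ δ (T + 1)) * 1 :=
        mul_le_mul_of_nonneg_left hp1 (by positivity)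
      rw [le_div_iff₀ hp, add_mul, mul_assoc (r : ℝ) (x / _), div_mul_cancel₀ _ hp.ne']
      have h3 : r * μ₀ * budget r μ₀ δ (T + 1) *
          (∑ t, (initDims n t : ℝ) + n (Fin.last (T + 1))) =
          r * x * μ₀ + n (Fin.last (T + 1)) * (r * μ₀ * budget r μ₀ δ (T + 1)) * 1 := by
        rw [hx]; ring
      rw [h3]
      linarith

theorem expectedCost_eq_expect {α : Type} (P : PMF (α × ℕ)) :
    expectedCost P = P.expect fun o => (o.2 : ℝ≥0∞) := rfl

open Classical in
theorem expectedCostOnSuccess_eq_expect {α : Type} (P : PMF (α × ℕ)) (M : α) :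
    expectedCostOnSuccess P M = P.expect fun o => if o.1 = M then (o.2 : ℝ≥0∞) else 0 := by
  simp [expectedCostOnSuccess, PMF.expect]

open Classical in
theorem successProb_add_expect_ne {α : Type} (P : PMF (α × ℕ)) (M : α) :
    successProb P M + (P.expect fun o => if o.1 = M then 0 else 1) = 1 := by
  have h : successProb P M = P.expect fun o => if o.1 = M then 1 else 0 := by
    simp [successProb, PMF.expect]
  rw [h, ← PMF.expect_add]
  refine (congrArg P.expect (funext fun o => ?_)).trans (P.expect_const 1)
  split_ifs <;> simp

end Completion

/-! ### The main theorem -/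

theorem theorem1 (σ : SamplingScheme) (T r : ℕ) (hT : 1 ≤ T) (hr : 1 ≤ r) (n : Fin T → ℕ)
    (a : (t : Fin T) → Fin r → EuclideanSpace ℝ (Fin (n t))) (M : Tensor n)
    (hM : M = cpTensor a) (hrank : tensorRank M = r) (μ₀ δ : ℝ) (hδ₀ : 0 < δ) (hδ₁ : δ < 1)
    (hcoh : ∀ t : Fin T, (t : ℕ) + 1 < T →
      coherence (Submodule.span ℝ (Set.range (a t))) ≤ μ₀) :
    ENNReal.ofReal (1 - 5 * δ * T * (r : ℝ) ^ T) ≤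
        successProb (tensorCompletion σ (budget r μ₀ δ) T n M) M ∧
      expectedCostOnSuccess (tensorCompletion σ (budget r μ₀ δ) T n M) M ≤
        ENNReal.ofReal (36 * (∑ t, (n t : ℝ)) * (r : ℝ) ^ ((T : ℝ) - 1 / 2) * μ₀ ^ (T - 1) *
          Real.log (2 * r / δ)) ∧
      ENNReal.ofReal (1 - 5 * δ * T * (r : ℝ) ^ T) *
          expectedCost (tensorCompletion σ (budget r μ₀ δ) T n M) ≤
        ENNReal.ofReal (36 * (∑ t, (n t : ℝ)) * (r : ℝ) ^ ((T : ℝ) - 1 / 2) * μ₀ ^ (T - 1) *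
          Real.log (2 * r / δ)) := by
  classical
  obtain ⟨T, rfl⟩ : ∃ S, T = S + 1 := ⟨T - 1, by omega⟩
  have hbudget : 36 * (∑ t, (n t : ℝ)) * (r : ℝ) ^ (((T + 1 : ℕ) : ℝ) - 1 / 2) *
      μ₀ ^ (T + 1 - 1) * Real.log (2 * r / δ) =
      budget r μ₀ δ (T + 1) * ∑ t, (n t : ℝ) := by
    rw [budget]; ring
  rw [hbudget]
  -- A nonzero entry of `M` makes all side lengths positive, and a nonzero summand there makes every
  -- factor span nonzero.
  obtain ⟨x, hx⟩ := exists_ne_zero_of_tensorRank_pos (M := M) (by omega)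
  have hn : ∀ t, 0 < n t := fun t => (x t).pos
  have hMx : ∀ x, M x = ∑ k, (fun _ => (1 : ℝ)) k * ∏ t, a t k (x t) := by
    intro x
    simp [hM, cpTensor]
  have hdim : ∀ t, 0 < Module.finrank ℝ (Submodule.span ℝ (Set.range (a t))) := by
    intro t
    rw [hMx] at hx
    obtain ⟨k, -, hk⟩ := Finset.exists_ne_zero_of_sum_ne_zero hx
    have hk0 : a t k ≠ 0 := by
      intro h0
      refine right_ne_zero_of_mul hk (Finset.prod_eq_zero (Finset.mem_univ t) ?_)
      simp [h0]
    refine Nat.pos_of_ne_zero fun h0 => hk0 ?_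
    have hmem : a t k ∈ Submodule.span ℝ (Set.range (a t)) :=
      Submodule.subset_span (Set.mem_range_self k)
    rwa [Submodule.finrank_eq_zero.1 h0, Submodule.mem_bot] at hmem
  have hcoh' : ∀ t : Fin T,
      coherence (Submodule.span ℝ (Set.range (a t.castSucc))) ≤ μ₀ := fun t =>
    hcoh t.castSucc (by simp)
  -- At order one no coherence is assumed and `μ₀` is an arbitrary real number, entering only as `μ₀
  -- ^ 0`.
  have hμ : T ≠ 0 → 1 ≤ μ₀ := fun h0 =>
    one_le_of_coherence_le (hn _) (hdim _) (hcoh' ⟨0, Nat.pos_of_ne_zero h0⟩)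
  have ha : ∀ t : Fin T, Spread (Submodule.span ℝ (Set.range (a t.castSucc)))
      (r * μ₀ / n t.castSucc) := by
    intro t w hw j
    refine (spread_of_coherence_le (hn _) (hdim _) (hcoh' t) w hw j).trans ?_
    have hμ0 : 0 ≤ μ₀ := (coherence_nonneg _).trans (hcoh' t)
    have hd : (Module.finrank ℝ (Submodule.span ℝ (Set.range (a t.castSucc))) : ℝ) ≤ r := by
      exact_mod_cast (finrank_range_le_card _).trans (Fintype.card_fin r).le
    rw [mul_comm μ₀]
    gcongr
  have hfail := expect_tensorCompletion_ne_le σ hr hδ₀ hδ₁ T hμ n hn a ha _ M hMx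
  refine ⟨?_, ?_, ?_⟩
  · have hsum := successProb_add_expect_ne (tensorCompletion σ (budget r μ₀ δ) (T + 1) n M) M
    have hle : ENNReal.ofReal (δ ^ 2 * (T + 1 : ℕ) * (r : ℝ) ^ (T + 1)) ≤
        ENNReal.ofReal (5 * δ * (T + 1 : ℕ) * (r : ℝ) ^ (T + 1)) := by
      refine ENNReal.ofReal_le_ofReal ?_
      gcongr
      nlinarith
    rw [ENNReal.ofReal_sub _ (by positivity), ENNReal.ofReal_one, tsub_le_iff_right, ← hsum]
    gcongr
    refine le_trans (le_of_eq ?_) (hfail.trans hle)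
    congr!
  · rw [expectedCostOnSuccess_eq_expect]
    convert expect_tensorCompletion_cost_on_success_le σ hr hδ₀ hδ₁ T hμ n a _ M hMx
  -- If `5 δ T r^T ≥ 1`, the left factor is truncated to `0` and nothing is claimed.
  · rcases le_or_gt 1 (5 * δ * (T + 1 : ℕ) * (r : ℝ) ^ (T + 1)) with h1 | h1
    · rw [ENNReal.ofReal_of_nonpos (by linarith), zero_mul]
      exact zero_le
    · have hcost := expect_tensorCompletion_cost_le σ hr hδ₀ hδ₁ T h1 hμ n hn a ha _ M hMx
      rw [expectedCost_eq_expect]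
      refine (mul_le_mul_right hcost _).trans ?_
      rw [← ENNReal.ofReal_mul (by linarith)]
      refine ENNReal.ofReal_le_ofReal ?_
      have hb := one_le_budget_one (μ₀ := μ₀) hr hδ₀ hδ₁
      have hr1 : (1 : ℝ) ≤ r := by exact_mod_cast hr
      have hB : 0 ≤ budget r μ₀ δ (T + 1) * ∑ t, (n t : ℝ) := by
        refine mul_nonneg ?_ (by positivity)
        rcases eq_or_ne T 0 with rfl | hT0
        · linarith
        · have := hμ hT0
          rw [budget_succ hr]
          positivity
      have hpow : (1 : ℝ) ≤ (r : ℝ) ^ (T + 1) := one_le_pow₀ hr1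
      have hlow : δ * (T + 1 : ℕ) * 1 ≤ δ * (T + 1 : ℕ) * (r : ℝ) ^ (T + 1) := by gcongr
      push_cast at hlow h1 ⊢
      have hT0 : (0 : ℝ) ≤ T := Nat.cast_nonneg T
      have hδ5 : 0 < 1 - 5 * δ := by nlinarith
      -- Bernoulli's inequality, with slack from `T ≤ T + 1` and `1 ≤ r^(T+1)`.
      have hbern : 1 - 5 * δ * (T + 1) * (r : ℝ) ^ (T + 1) ≤ (1 - 5 * δ) ^ T := by
        have := one_add_mul_le_pow (a := -(5 * δ)) (by linarith) T
        rw [← sub_eq_add_neg] at this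
        nlinarith
      rw [← mul_div_assoc, div_le_iff₀ (by positivity), mul_comm]
      exact mul_le_mul_of_nonneg_left hbern hB
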